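/- Let $(N^{2n+1},\varphi,\xi,\eta,g)$ be a contact metric manifold, i.e. a smooth (Hausdorff) manifold with smooth tensor fields such that $\varphi^2=-I+\eta\otimes\xi$, $\eta(\xi)=1$, $g(\varphi X,\varphi Y)=g(X,Y)-\eta(X)\eta(Y)$ and $g(X,\varphi Y)=d\eta(X,Y)$, where $d\eta(X,Y)=\tfrac12\big(X\eta(Y)-Y\eta(X)-\eta([X,Y])\big)$. Assume that it is a Sasakian space form of constant $\varphi$-sectional curvature $c\neq 1$: it is normal, $N_\varphi+2\,d\eta\otimes\xi=0$ with $N_\varphi(X,Y)=[\varphi X,\varphi Y]-\varphi[\varphi X,Y]-\varphi[X,\varphi Y]+\varphi^2[X,Y]$, and every plane spanned by $X,\varphi X$ with $X$ a unit vector orthogonal to $\xi$ has sectional curvature $c$. Let $\nabla$ be the Levi-Civita connection and $R(X,Y)=\nabla_X\nabla_Y-\nabla_Y\nabla_X-\nabla_{[X,Y]}$. Let $I\subseteq\mathbb{R}$ be a non-empty open interval and $\gamma:I\to N$ a smooth Legendre curve (i.e. $\eta(\gamma')=0$) which is a Frenet curve of osculating order $r$, $1\le r\le 2n+1$: there are smooth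 orthonormal vector fields $E_1,\dots,E_r$ along $\gamma$ and smooth positive functions $\kappa_1,\dots,\kappa_{r-1}$ on $I$ with $E_1=T:=\gamma'$ and $\nabla_TE_i=-\kappa_{i-1}E_{i-1}+\kappa_iE_{i+1}$ for $1\le i\le r$ (the terms with $\kappa_0$ and $\kappa_r$ being absent). A geodesic is a Frenet curve of osculating order $1$; a helix is a Frenet curve of osculating order $3$ with $\kappa_1,\kappa_2$ constant. The curve $\gamma$ is biharmonic if its bitension field $\tau_2(\gamma)=\nabla_T^3T-R(T,\nabla_TT)T$ vanishes, and proper-biharmonic if moreover it is not harmonic, i.e. $\nabla_TT\not\equiv 0$. Suppose that $E_2(t)$ is parallel to $\varphi T(t)$ for every $t\in I$ (a condition that is void if $r=1$). Then: 0) If $r\ge 2$, then $\{T,\varphi T,\xi\}$ is, up to a sign, the Frenet frame field of $\gamma$: $r=3$ and there is a constant $\varepsilon\in\{1,-1\}$ such that $E_1=T$, $E_2=\varepsilon\,\varphi T$, $E_3=\varepsilon\,\xi$ on $I$. 1) If $c<1$, then $\gamma$ is biharmonic if and only if it is a geodesic. 2) If $c>1$, then $\gamma$ is proper-biharmonic if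 and only if it is a helix with $\kappa_1^2=c-1$ and $\kappa_2=1$. -/

import Mathlib

open scoped Manifold ContDiff Bundle

noncomputable section

namespace Sasaki

/-! ### Riemannian geometry in the preferred charts

A smooth manifold of dimension `d` is modelled on `EuclideanSpace ℝ (Fin d)`, and the tangent
space at `x` is identified with the model space by the differential at `x` of the preferred
chart at `x`. -/

/-- The model space of a `d`-dimensional manifold. -/
abbrev Model (d : ℕ) : Type := EuclideanSpace ℝ (Fin d)

/-- Smooth Riemannian metrics on a `d`-dimensional manifold. -/
abbrev Metric (d : ℕ) (N : Type*) [TopologicalSpace N] [ChartedSpace (Model d) N]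
    [IsManifold (𝓡 d) ∞ N] :=
  Bundle.ContMDiffRiemannianMetric (𝓡 d) ∞ (Model d) (fun x : N => TangentSpace (𝓡 d) x)

section Riemannian

variable {d : ℕ} {N : Type*} [TopologicalSpace N] [ChartedSpace (Model d) N]
  [IsManifold (𝓡 d) ∞ N]

/-- For a point `x` of the domain of the preferred chart at `p`, the inverse of the differential
of this chart at `x`; it sends a coordinate vector to a tangent vector at `x`. -/
def coordToTangent (p x : N) : Model d →L[ℝ] TangentSpace (𝓡 d) x :=
  (trivializationAt (Model d) (fun x : N => TangentSpace (𝓡 d) x) p).symmL ℝ x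

/-- For a point `x` of the domain of the preferred chart at `p`, the differential of this chart
at `x`; it sends a tangent vector at `x` to its coordinate vector. -/
def tangentToCoord (p x : N) : TangentSpace (𝓡 d) x →L[ℝ] Model d :=
  (trivializationAt (Model d) (fun x : N => TangentSpace (𝓡 d) x) p).continuousLinearMapAt ℝ x

/-- The metric tensor written in the preferred chart at `p`, as a function of the coordinates
`y` with values in the bilinear forms:
`G y u v` is the scalar product of the vectors with coordinates `u` and `v` at the point `y`. -/
def metricInChart (g : Metric d N) (p : N) (y : Model d) : Model d →L[ℝ] Model d →L[ℝ] ℝ :=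
  let x : N := (extChartAt (𝓡 d) p).symm y
  ContinuousLinearMap.precomp ℝ (coordToTangent p x) ∘L g.inner x ∘L coordToTangent p x

/-- The Christoffel symbols of the first kind in the preferred chart at `p`:
`w ↦ (∂_u G(v, w) + ∂_v G(u, w) - ∂_w G(u, v)) / 2`. -/
def christoffelFirst (g : Metric d N) (p : N) (y u v : Model d) : Model d →L[ℝ] ℝ :=
  let dG := fderiv ℝ (metricInChart g p) y
  (1 / 2 : ℝ) • (dG u v + dG v u - (dG.flip u).flip v)

/-- The Christoffel symbols of the second kind (of the Levi-Civita connection) in the preferred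
chart at `p`: `Γ(u, v)` is the vector with `G(Γ(u, v), w) = christoffelFirst u v w` for all `w`. -/
def christoffel (g : Metric d N) (p : N) (y u v : Model d) : Model d :=
  (metricInChart g p y).inverse (christoffelFirst g p y u v)

/-- The curvature tensor `R(X, Y) = ∇_X ∇_Y - ∇_Y ∇_X - ∇_[X, Y]` of the Levi-Civita connection
at `x`, by its classical expression in the preferred chart at `x`:
`R(u, v) w = ∂_u Γ(v, w) - ∂_v Γ(u, w) + Γ(u, Γ(v, w)) - Γ(v, Γ(u, w))`. -/
def curvature (g : Metric d N) (x : N) (u v w : TangentSpace (𝓡 d) x) : TangentSpace (𝓡 d) x :=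
  let y₀ : Model d := extChartAt (𝓡 d) x x
  let u' : Model d := u
  let v' : Model d := v
  let w' : Model d := w
  (fderiv ℝ (fun y => christoffel g x y v' w') y₀ u'
    - fderiv ℝ (fun y => christoffel g x y u' w') y₀ v'
    + christoffel g x y₀ u' (christoffel g x y₀ v' w')
    - christoffel g x y₀ v' (christoffel g x y₀ u' w') : Model d)

/-- The sectional curvature of the plane spanned by `u` and `v`. -/
def sectionalCurvature (g : Metric d N) (x : N) (u v : TangentSpace (𝓡 d) x) : ℝ :=
  g.inner x (curvature g x u v v) u /
    (g.inner x u u * g.inner x v v - g.inner x u v ^ 2)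

/-! ### Curves -/

/-- The velocity `T = γ'` of a curve. -/
def velocity (γ : ℝ → N) (t : ℝ) : TangentSpace (𝓡 d) (γ t) :=
  mfderiv 𝓘(ℝ, ℝ) (𝓡 d) γ t (1 : ℝ)

/-- The covariant derivative `∇_T V` (for the Levi-Civita connection) of a vector field `V` along
the curve `γ`: in the preferred chart at `γ t` it is `V' + Γ(γ', V)`. -/
def covDerivAlong (g : Metric d N) (γ : ℝ → N) (V : ∀ t, TangentSpace (𝓡 d) (γ t)) (t : ℝ) :
    TangentSpace (𝓡 d) (γ t) :=
  (deriv (fun s => tangentToCoord (γ t) (γ s) (V s)) t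
    + christoffel g (γ t) (extChartAt (𝓡 d) (γ t) (γ t)) (velocity (d := d) γ t) (V t) : Model d)

/-- The tension field `τ(γ) = trace ∇dγ = ∇_T T` of a curve. -/
def tension (g : Metric d N) (γ : ℝ → N) (t : ℝ) : TangentSpace (𝓡 d) (γ t) :=
  covDerivAlong g γ (velocity γ) t

/-- The bitension field `τ₂(γ) = -Δ τ(γ) - trace R(dγ, τ(γ)) dγ` of a curve, that is,
`τ₂(γ) = ∇_T ∇_T τ(γ) - R(T, τ(γ)) T`. -/
def bitension (g : Metric d N) (γ : ℝ → N) (t : ℝ) : TangentSpace (𝓡 d) (γ t) :=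
  covDerivAlong g γ (covDerivAlong g γ (tension g γ)) t
    - curvature g (γ t) (velocity γ t) (tension g γ t) (velocity γ t)

/-- Harmonic curves. -/
def IsHarmonic (g : Metric d N) (J : Set ℝ) (γ : ℝ → N) : Prop :=
  ∀ t ∈ J, tension g γ t = 0

/-- Biharmonic curves: the bitension field vanishes (the Euler-Lagrange equation of the
bienergy). -/
def IsBiharmonic (g : Metric d N) (J : Set ℝ) (γ : ℝ → N) : Prop :=
  ∀ t ∈ J, bitension g γ t = 0

/-- Proper-biharmonic curves: biharmonic and not harmonic. -/
def IsProperBiharmonic (g : Metric d N) (J : Set ℝ) (γ : ℝ → N) : Prop :=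
  IsBiharmonic g J γ ∧ ¬ IsHarmonic g J γ

/-- `γ`, restricted to `J`, is a Frenet curve of osculating order `r` with Frenet frame field
`E 1, …, E r` and curvatures `κ 1, …, κ (r - 1)`; the values of `E` and `κ` at other indices play
no role. In particular `γ` is parametrized by arc length. -/
structure IsFrenet (g : Metric d N) (J : Set ℝ) (γ : ℝ → N) (r : ℕ)
    (E : ℕ → ∀ t, TangentSpace (𝓡 d) (γ t)) (κ : ℕ → ℝ → ℝ) : Prop where
  one_le : 1 ≤ r
  le_dim : r ≤ d
  smooth_frame : ∀ i ∈ Set.Icc 1 r,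
    ContMDiffOn 𝓘(ℝ, ℝ) (𝓡 d).tangent ∞
      (fun t => (⟨γ t, E i t⟩ : TangentBundle (𝓡 d) N)) J
  smooth_curvature : ∀ i ∈ Set.Ico 1 r, ContDiffOn ℝ ∞ (κ i) J
  orthonormal : ∀ t ∈ J, ∀ i ∈ Set.Icc 1 r, ∀ j ∈ Set.Icc 1 r,
    g.inner (γ t) (E i t) (E j t) = if i = j then 1 else 0
  first : ∀ t ∈ J, E 1 t = velocity γ t
  curvature_pos : ∀ t ∈ J, ∀ i ∈ Set.Ico 1 r, 0 < κ i t
  frenet : ∀ t ∈ J, ∀ i ∈ Set.Icc 1 r,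
    covDerivAlong g γ (E i) t =
      (if 1 < i then -(κ (i - 1) t • E (i - 1) t) else 0)
        + (if i < r then κ i t • E (i + 1) t else 0)

/-- A geodesic is a Frenet curve of osculating order `1`. -/
def IsGeodesic (g : Metric d N) (J : Set ℝ) (γ : ℝ → N) : Prop :=
  ∃ E κ, IsFrenet g J γ 1 E κ

/-- A helix with curvatures `k₁`, `k₂` is a Frenet curve of osculating order `3` whose curvatures
are constant, equal to `k₁` and `k₂`. -/
def IsHelix (g : Metric d N) (J : Set ℝ) (γ : ℝ → N) (k₁ k₂ : ℝ) : Prop :=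
  ∃ E κ, IsFrenet g J γ 3 E κ ∧ ∀ t ∈ J, κ 1 t = k₁ ∧ κ 2 t = k₂

/-! ### Sasakian space forms -/

/-- Smooth vector fields. -/
def IsSmoothField (X : ∀ x : N, TangentSpace (𝓡 d) x) : Prop :=
  ContMDiff (𝓡 d) (𝓡 d).tangent ∞ (fun x => (⟨x, X x⟩ : TangentBundle (𝓡 d) N))

/-- The exterior derivative of a `1`-form `η`, with the normalization
`dη(X, Y) = (X(η(Y)) - Y(η(X)) - η([X, Y])) / 2` of contact metric geometry. -/
def extDerivForm (η : ∀ x : N, TangentSpace (𝓡 d) x →L[ℝ] ℝ)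
    (X Y : ∀ x : N, TangentSpace (𝓡 d) x) (x : N) : ℝ :=
  (1 / 2 : ℝ) * (mvfderiv (𝓡 d) (fun y => η y (Y y)) x (X x)
    - mvfderiv (𝓡 d) (fun y => η y (X y)) x (Y x)
    - η x (VectorField.mlieBracket (𝓡 d) X Y x))

/-- The Nijenhuis tensor field of a `(1, 1)`-tensor field,
`N_φ(X, Y) = [φX, φY] - φ[φX, Y] - φ[X, φY] + φ²[X, Y]`. -/
def nijenhuis (φ : ∀ x : N, TangentSpace (𝓡 d) x →L[ℝ] TangentSpace (𝓡 d) x)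
    (X Y : ∀ x : N, TangentSpace (𝓡 d) x) (x : N) : TangentSpace (𝓡 d) x :=
  VectorField.mlieBracket (𝓡 d) (fun y => φ y (X y)) (fun y => φ y (Y y)) x
    - φ x (VectorField.mlieBracket (𝓡 d) (fun y => φ y (X y)) Y x)
    - φ x (VectorField.mlieBracket (𝓡 d) X (fun y => φ y (Y y)) x)
    + φ x (φ x (VectorField.mlieBracket (𝓡 d) X Y x))

end Riemannian

/-- Contact metric structures `(φ, ξ, η, g)` on a manifold of dimension `2n+1`. -/
structure ContactMetricStructure (n : ℕ) (N : Type*) [TopologicalSpace N]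
    [ChartedSpace (Model (2 * n + 1)) N] [IsManifold (𝓡 (2 * n + 1)) ∞ N] where
  φ : ∀ x : N, TangentSpace (𝓡 (2 * n + 1)) x →L[ℝ] TangentSpace (𝓡 (2 * n + 1)) x
  ξ : ∀ x : N, TangentSpace (𝓡 (2 * n + 1)) x
  η : ∀ x : N, TangentSpace (𝓡 (2 * n + 1)) x →L[ℝ] ℝ
  g : Metric (2 * n + 1) N
  smooth_φ : ContMDiff (𝓡 (2 * n + 1))
    ((𝓡 (2 * n + 1)).prod 𝓘(ℝ, Model (2 * n + 1) →L[ℝ] Model (2 * n + 1))) ∞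
    (fun x => Bundle.TotalSpace.mk' (Model (2 * n + 1) →L[ℝ] Model (2 * n + 1))
      (E := fun x : N => TangentSpace (𝓡 (2 * n + 1)) x →L[ℝ] TangentSpace (𝓡 (2 * n + 1)) x)
      x (φ x))
  smooth_ξ : IsSmoothField ξ
  smooth_η : ContMDiff (𝓡 (2 * n + 1))
    ((𝓡 (2 * n + 1)).prod 𝓘(ℝ, Model (2 * n + 1) →L[ℝ] ℝ)) ∞
    (fun x => Bundle.TotalSpace.mk' (Model (2 * n + 1) →L[ℝ] ℝ)
      (E := fun x : N => TangentSpace (𝓡 (2 * n + 1)) x →L[ℝ] Bundle.Trivial N ℝ x) x (η x))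
  φ_sq : ∀ x v, φ x (φ x v) = -v + η x v • ξ x
  η_ξ : ∀ x, η x (ξ x) = 1
  g_φ : ∀ x u v, g.inner x (φ x u) (φ x v) = g.inner x u v - η x u * η x v
  g_dη : ∀ X Y, IsSmoothField X → IsSmoothField Y →
    ∀ x, g.inner x (X x) (φ x (Y x)) = extDerivForm η X Y x

namespace ContactMetricStructure

variable {n : ℕ} {N : Type*} [TopologicalSpace N] [ChartedSpace (Model (2 * n + 1)) N]
  [IsManifold (𝓡 (2 * n + 1)) ∞ N]

/-- A contact metric structure is Sasakian if it is normal: `N_φ + 2 dη ⊗ ξ = 0`. -/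
def IsSasakian (S : ContactMetricStructure n N) : Prop :=
  ∀ X Y, IsSmoothField X → IsSmoothField Y →
    ∀ x, nijenhuis S.φ X Y x + (2 * extDerivForm S.η X Y x) • S.ξ x = 0

/-- The `φ`-sectional curvature is constant, equal to `c`: every plane spanned by `u` and `φ u`,
where `u` is a unit vector orthogonal to `ξ`, has sectional curvature `c`. -/
def HasConstantPhiSectionalCurvature (S : ContactMetricStructure n N) (c : ℝ) : Prop :=
  ∀ (x : N) (u : TangentSpace (𝓡 (2 * n + 1)) x),
    S.g.inner x u u = 1 → S.g.inner x u (S.ξ x) = 0 →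
      sectionalCurvature S.g x u (S.φ x u) = c

/-- A Sasakian space form `N(c)` is a Sasakian manifold of constant `φ`-sectional
curvature `c`. -/
def IsSasakianSpaceForm (S : ContactMetricStructure n N) (c : ℝ) : Prop :=
  S.IsSasakian ∧ S.HasConstantPhiSectionalCurvature c

/-- Legendre curves: integral curves of the contact distribution `η = 0`. -/
def IsLegendre (S : ContactMetricStructure n N) (J : Set ℝ) (γ : ℝ → N) : Prop :=
  ∀ t ∈ J, S.η (γ t) (velocity γ t) = 0

end ContactMetricStructure

end Sasaki

end

/-! Two tensor identities of a Sasakian manifold govern everything: $\nabla_u\xi=-\varphi u$ and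
$(\nabla_u\varphi)v=g(u,v)\xi-\eta(v)u$. Along a Legendre curve they give $\nabla_T(\varphi
T)=\xi+\varphi\nabla_TT$. If $E_2$ is parallel to $\varphi T$, the factor $g(E_2,\varphi T)$ is
continuous and equals $\pm1$, hence is a constant $\varepsilon$ on the interval. Comparing
$\nabla_T(\varepsilon\varphi T)$ with the Frenet equation leaves $\kappa_2E_3=\varepsilon\xi$, so
$\kappa_2=1$ and $E_3=\varepsilon\xi$; then $\nabla_TE_3=-\varepsilon\varphi T=-E_2$ leaves no room
for an $E_4$ (`exists_sign`, `frenet_frame`).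

In a space form of constant $\varphi$-sectional curvature, $R(T,\varphi T)T=-c\,\varphi T$.
Expanding the bitension field in the Frenet frame (`bitension_eq`) gives
$\tau_2=-3\kappa_1\kappa_1'E_1+(\kappa_1''-\kappa_1^3-\kappa_1+c\kappa_1)E_2+2\kappa_1'E_3$, so its
vanishing means that $\kappa_1$ is constant with $\kappa_1^2=c-1$ (`isBiharmonic_iff`). This is
impossible for $c<1$, and for $c>1$ it is the helix condition.

The Sasakian identities are derived from the definition. In a chart (`LocalSasaki`) the defining
equations are differentiated, which yields linear relations at a point between $\nabla\xi$ and
$\nabla\varphi$ (`SasakiDerivatives`); pure algebra solves them (`A_eq`, `P_eq`). The solutions are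
first-order equations for $\xi$ and $\varphi$, and the symmetry of second derivatives turns them
into curvature identities (`SasakiCurvature`). Algebra then determines $R(u,\varphi u)u$ for
$u\perp\xi$ (`curv_eq_neg`). Bump functions make the transfer to the chart possible, since the
hypotheses on $d\eta$ and $N_\varphi$ speak of global vector fields (`exists_localSasaki`). -/

noncomputable section

namespace Sasaki

/-! ### Linear algebra at a point -/

section Pointwise

variable {V : Type*} [NormedAddCommGroup V] [NormedSpace ℝ V]

/-- Almost contact metric structures on a vector space. -/
structure AlmostContactMetric (G : V →L[ℝ] V →L[ℝ] ℝ) (φ : V →L[ℝ] V) (ξ : V)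
    (η : V →L[ℝ] ℝ) : Prop where
  symm : ∀ u v, G u v = G v u
  pos : ∀ u, u ≠ 0 → 0 < G u u
  φ_sq : ∀ v, φ (φ v) = -v + η v • ξ
  η_ξ : η ξ = 1
  g_φ : ∀ u v, G (φ u) (φ v) = G u v - η u * η v

namespace AlmostContactMetric

variable {G : V →L[ℝ] V →L[ℝ] ℝ} {φ : V →L[ℝ] V} {ξ : V} {η : V →L[ℝ] ℝ}

theorem eq_zero (h : AlmostContactMetric G φ ξ η) {u : V} (hu : G u u = 0) : u = 0 := by
  by_contra hne
  exact (h.pos u hne).ne' hu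

theorem eq_of_forall (h : AlmostContactMetric G φ ξ η) {u v : V} (huv : ∀ w, G u w = G v w) :
    u = v := by
  refine sub_eq_zero.1 (h.eq_zero ?_)
  rw [map_sub G, sub_apply, huv, sub_self]

theorem ξ_ne_zero (h : AlmostContactMetric G φ ξ η) : ξ ≠ 0 := by
  rintro rfl
  simpa using h.η_ξ

/-- Since $\varphi^2\xi=0$, applying $\varphi^2$ to $\varphi\xi$ shows $\varphi\xi=a\xi$; applying
$\varphi$ once more gives $a^2\xi=0$. -/
theorem φ_ξ (h : AlmostContactMetric G φ ξ η) : φ ξ = 0 := by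
  have h1 : φ (φ ξ) = 0 := by rw [h.φ_sq, h.η_ξ]; simp
  have h2 : φ ξ = η (φ ξ) • ξ := by
    have := h.φ_sq (φ ξ)
    rw [h1, map_zero] at this
    exact (neg_add_eq_zero.1 this.symm)
  have h3 : (η (φ ξ) * η (φ ξ)) • ξ = 0 := by
    have := h1
    rw [h2, map_smul, h2, smul_smul] at this
    simpa [h.η_ξ] using this
  have h4 : η (φ ξ) = 0 := by simpa [h.ξ_ne_zero] using h3
  rw [h2, h4, zero_smul]

/-- Compute $\varphi^3v$ as $\varphi^2(\varphi v)$ and as $\varphi(\varphi^2v)$: the results differ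
by $\eta(\varphi v)\xi$. -/
theorem η_φ (h : AlmostContactMetric G φ ξ η) (v : V) : η (φ v) = 0 := by
  have h1 := h.φ_sq (φ v)
  rw [h.φ_sq v, map_add, map_neg, map_smul, h.φ_ξ] at h1
  simpa [h.ξ_ne_zero] using h1

theorem g_ξ_right (h : AlmostContactMetric G φ ξ η) (u : V) : G u ξ = η u := by
  have := h.g_φ u ξ
  rw [h.φ_ξ, h.η_ξ, map_zero] at this
  linarith

theorem g_ξ_left (h : AlmostContactMetric G φ ξ η) (u : V) : G ξ u = η u := by
  rw [h.symm, h.g_ξ_right]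

theorem g_φ_left (h : AlmostContactMetric G φ ξ η) (u v : V) : G (φ u) v = -G u (φ v) := by
  have := h.g_φ u (φ v)
  rw [h.φ_sq, h.η_φ, map_add, map_neg, map_smul, h.g_ξ_right, h.η_φ] at this
  simp only [smul_zero, add_zero, mul_zero, sub_zero] at this
  linarith

theorem g_φ_self (h : AlmostContactMetric G φ ξ η) (u : V) : G (φ u) u = 0 := by
  have := h.g_φ_left u u
  rw [h.symm u] at this
  linarith

end AlmostContactMetric

/-- The equations at a point satisfied by `A = ∇ξ` and `P u v = (∇_u φ) v` on a normal contact
metric manifold. -/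
structure SasakiDerivatives (G : V →L[ℝ] V →L[ℝ] ℝ) (φ : V →L[ℝ] V) (ξ : V) (η : V →L[ℝ] ℝ)
    (A : V →L[ℝ] V) (P : V →L[ℝ] V →L[ℝ] V) : Prop extends AlmostContactMetric G φ ξ η where
  contact : ∀ u v, G (A u) v - G (A v) u = 2 * G u (φ v)
  closed : ∀ u v w, G v (P u w) + G w (P v u) + G u (P w v) = 0
  normal : ∀ u v, P (φ u) v - P (φ v) u + φ (P v u) - φ (P u v) + (2 * G u (φ v)) • ξ = 0
  deriv_sq : ∀ u v, P u (φ v) + φ (P u v) = G (A u) v • ξ + η v • A u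
  skew : ∀ u v w, G (P u v) w = -G v (P u w)
  unit : ∀ u, G (A u) ξ = 0

namespace SasakiDerivatives

variable {G : V →L[ℝ] V →L[ℝ] ℝ} {φ : V →L[ℝ] V} {ξ : V} {η : V →L[ℝ] ℝ}
  {A : V →L[ℝ] V} {P : V →L[ℝ] V →L[ℝ] V}

theorem η_A (h : SasakiDerivatives G φ ξ η A P) (u : V) : η (A u) = 0 := by
  rw [← h.g_ξ_right, h.unit]

theorem A_ξ (h : SasakiDerivatives G φ ξ η A P) : A ξ = 0 := h.eq_of_forall fun w => by
  have := h.contact w ξ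
  rw [h.unit, h.φ_ξ] at this
  simp at this ⊢
  linarith

theorem P_ξ (h : SasakiDerivatives G φ ξ η A P) (u : V) : P u ξ = -φ (A u) := by
  have h1 := h.deriv_sq u ξ
  rw [h.φ_ξ, map_zero, h.unit, h.η_ξ, zero_smul, one_smul, zero_add, zero_add] at h1
  have h2 : η (P u ξ) = 0 := by
    have := h.skew u ξ ξ
    rw [h.g_ξ_right, h.g_ξ_left] at this
    linarith
  have h3 := h.φ_sq (P u ξ)
  rw [h1, h2, zero_smul, add_zero] at h3
  rw [h3, neg_neg]

/-- In the closedness relation with one argument $\xi$, the other two terms involve only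
$P_\cdot\,\xi=-\varphi A$. The contact relation then moves $A$ from $v$ to $\varphi w$. -/
theorem P_ξ_left (h : SasakiDerivatives G φ ξ η A P) (w : V) :
    P ξ w = -φ (A w) - A (φ w) - (2 : ℝ) • φ (φ w) := by
  refine h.eq_of_forall fun v => ?_
  have h1 := h.closed ξ v w
  have h2 := h.skew w ξ v
  have h3 := h.contact (φ w) v
  rw [h.P_ξ] at h1 h2
  simp only [map_neg, map_sub, map_smul, neg_apply, sub_apply, smul_apply, smul_eq_mul] at h1 h2 ⊢
  have h4 := h.g_φ_left w (A v)
  rw [h.symm (A v)] at h3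
  have h5 := h.g_φ_left (φ w) v
  have h6 := h.symm (P ξ w) v
  linarith

/-- On a Sasakian manifold `∇_u ξ = -φ u`. -/
theorem A_eq (h : SasakiDerivatives G φ ξ η A P) (u : V) : A u = -φ u := by
  -- Normality with second argument $\xi$: the terms $\varphi^2Au$ cancel, leaving $2(\varphi
  -- u-\varphi A\varphi u)=0$. This fixes $A$ on the image of $\varphi$, and $A\xi=0$ covers the
  -- rest.
  have AφA : ∀ u, φ (A (φ u)) = φ u := fun u => by
    have h1 := h.normal u ξ
    rw [h.P_ξ, h.P_ξ, h.P_ξ_left, h.φ_ξ] at h1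
    simp only [map_add, map_neg, map_sub, map_smul, map_zero, mul_zero, zero_smul, smul_zero,
      h.φ_sq, h.η_A, h.φ_ξ, zero_apply, add_zero, sub_zero] at h1
    have h2 : (2 : ℝ) • (φ u - φ (A (φ u))) = 0 := by
      rw [← h1]; module
    exact (sub_eq_zero.1 ((smul_eq_zero.1 h2).resolve_left two_ne_zero)).symm
  have Aφ : ∀ u, A (φ u) = -φ (φ u) := fun u => by
    have := h.φ_sq (A (φ u))
    rw [AφA, h.η_A, zero_smul, add_zero] at this
    rw [this, neg_neg]
  have h1 := Aφ (φ u)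
  rw [h.φ_sq u, map_add, map_smul, h.A_ξ, smul_zero, add_zero, map_neg, map_add, map_neg, map_smul,
    h.φ_ξ, smul_zero, add_zero, neg_neg] at h1
  rw [← h1, neg_neg]

/-- On a Sasakian manifold `(∇_u φ) v = g(u, v) ξ - η(v) u`. -/
theorem P_eq (h : SasakiDerivatives G φ ξ η A P) (u v : V) : P u v = G u v • ξ - η v • u := by
  -- The defect `q` of the claimed formula satisfies homogeneous versions of all the relations, so
  -- it remains to show that these force it to vanish.
  set q : V → V → V → ℝ := fun u v w => G (P u v) w - (G u v * η w - η v * G u w) with hq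
  have q_skew : ∀ u v w, q u v w = -q u w v := fun u v w => by
    simp only [hq]
    rw [h.skew, h.symm v]
    ring
  have q_cyc : ∀ u v w, q u v w + q v w u + q w u v = 0 := fun u v w => by
    have h1 := h.closed u w v
    simp only [hq]
    rw [h.symm (P u v), h.symm (P v w), h.symm (P w u), h.symm v u, h.symm w u, h.symm w v]
    linarith
  have q_φ : ∀ u v w, q u (φ v) w = q u v (φ w) := fun u v w => by
    have h1 := congrArg (fun x => G x w) (h.deriv_sq u v)
    simp only [hq, h.A_eq, map_add, map_neg, map_smul, add_apply, neg_apply, smul_apply,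
      smul_eq_mul, h.g_ξ_left, h.η_φ] at h1 ⊢
    have h2 := h.g_φ_left (P u v) w
    have h3 := h.g_φ_left u v
    have h4 := h.g_φ_left u w
    rw [h3, h4] at h1
    linarith
  have q_normal : ∀ u v w,
      q (φ u) v w - q (φ v) u w - q v u (φ w) + q u v (φ w) = 0 := fun u v w => by
    have h1 := congrArg (fun x => G x w) (h.normal u v)
    simp only [hq, map_add, map_sub, map_smul, add_apply, sub_apply, smul_apply,
      smul_eq_mul, h.g_ξ_left, h.η_φ, map_zero, zero_apply, h.g_φ_left] at h1 ⊢
    rw [h.symm v (φ u), h.g_φ_left u v]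
    linarith
  have s_rel : ∀ u v w, q (φ u) v w + q (φ v) w u - q (φ w) u v = 0 := fun u v w => by
    have h1 := q_normal u v w
    have h2 := q_cyc u v (φ w)
    have h3 := q_skew v (φ w) u
    have h4 := q_skew (φ v) u w
    linarith
  -- For $s(u,v,w)=q(\varphi u,v,w)$, the relation and its cyclic shifts say that each of three
  -- numbers is the sum of the other two, so all three are zero.
  have s_zero : ∀ u v w, q (φ u) v w = 0 := fun u v w => by
    have h1 := s_rel u v w
    have h2 := s_rel v w u
    have h3 := s_rel w u v
    linarith
  have q_ξ : ∀ v w, q ξ v w = 0 := fun v w => by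
    have h1 : P ξ v = 0 := by
      rw [h.P_ξ_left, h.A_eq, h.A_eq, map_neg]
      module
    simp only [hq, h1, h.g_ξ_left, map_zero, zero_apply]
    ring
  refine h.eq_of_forall fun w => ?_
  have h1 : q u v w = 0 := by
    -- Since $\varphi^2u=-u+\eta(u)\xi$, the first slot of `q` splits into a part in the image of
    -- $\varphi$ and a part along $\xi$.
    have h2 := s_zero (φ u) v w
    have h3 := q_ξ v w
    simp only [hq, h.φ_sq, map_add, map_neg, map_smul, add_apply, neg_apply, smul_apply,
      smul_eq_mul] at h2 h3 ⊢
    linear_combination -h2 + η u * h3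
  simp only [hq, map_sub, map_smul, sub_apply, smul_apply, smul_eq_mul, h.g_ξ_left] at h1 ⊢
  linarith

end SasakiDerivatives
end Pointwise

/-! ### Algebra of the curvature tensor of a Sasakian space form at a point -/

section CurvatureAlgebra

variable {V : Type*} [NormedAddCommGroup V] [NormedSpace ℝ V]

/-- The curvature at a point, from the value `Γ` and the derivative `D` of the Christoffel
symbols. -/
def curv (D : V →L[ℝ] V →L[ℝ] V →L[ℝ] V) (Γ : V →L[ℝ] V →L[ℝ] V) (u v w : V) : V :=
  D u v w - D v u w + Γ u (Γ v w) - Γ v (Γ u w)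

variable (D : V →L[ℝ] V →L[ℝ] V →L[ℝ] V) (Γ : V →L[ℝ] V →L[ℝ] V)

set_option synthInstance.maxHeartbeats 200000

theorem curv_swap (u v w : V) : curv D Γ u v w = -curv D Γ v u w := by
  simp only [curv]; abel

theorem curv_add_left (u u' v w : V) :
    curv D Γ (u + u') v w = curv D Γ u v w + curv D Γ u' v w := by
  simp only [curv, map_add, add_apply]; abel

theorem curv_add_middle (u v v' w : V) :
    curv D Γ u (v + v') w = curv D Γ u v w + curv D Γ u v' w := by
  simp only [curv, map_add, add_apply]; abel

theorem curv_add_right (u v w w' : V) :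
    curv D Γ u v (w + w') = curv D Γ u v w + curv D Γ u v w' := by
  simp only [curv, map_add]; abel

theorem curv_smul_left (a : ℝ) (u v w : V) : curv D Γ (a • u) v w = a • curv D Γ u v w := by
  simp only [curv, map_smul, smul_apply]; module

theorem curv_smul_middle (a : ℝ) (u v w : V) : curv D Γ u (a • v) w = a • curv D Γ u v w := by
  simp only [curv, map_smul, smul_apply]; module

theorem curv_smul_right (a : ℝ) (u v w : V) : curv D Γ u v (a • w) = a • curv D Γ u v w := by
  simp only [curv, map_smul]; module

variable {D Γ}

theorem curv_cyclic (hD : ∀ u v w, D u v w = D u w v) (hΓ : ∀ u v, Γ u v = Γ v u) (u v w : V) :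
    curv D Γ u v w + curv D Γ v w u + curv D Γ w u v = 0 := by
  simp only [curv]
  rw [hD u v w, hD v u w, hD w v u, hΓ u v, hΓ v w, hΓ w u]
  abel

/-- The equations at a point satisfied by the curvature of a Sasakian manifold. -/
structure SasakiCurvature (G : V →L[ℝ] V →L[ℝ] ℝ) (φ : V →L[ℝ] V) (ξ : V) (η : V →L[ℝ] ℝ)
    (D : V →L[ℝ] V →L[ℝ] V →L[ℝ] V) (Γ : V →L[ℝ] V →L[ℝ] V) : Prop
    extends AlmostContactMetric G φ ξ η where
  D_symm : ∀ u v w, D u v w = D u w v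
  Γ_symm : ∀ u v, Γ u v = Γ v u
  curv_skew : ∀ u v w z, G (curv D Γ u v w) z = -G (curv D Γ u v z) w
  curv_ξ : ∀ u v, curv D Γ u v ξ = η v • u - η u • v
  curv_φ : ∀ u v w, curv D Γ u v (φ w) - φ (curv D Γ u v w) =
    -(G v w • φ u) + G (φ u) w • v + G u w • φ v - G (φ v) w • u

namespace SasakiCurvature

variable {G : V →L[ℝ] V →L[ℝ] ℝ} {φ : V →L[ℝ] V} {ξ : V} {η : V →L[ℝ] ℝ}

/-- The classical octahedron argument: four instances of the first Bianchi identity, combined by the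
skew-symmetry in each pair of arguments. -/
theorem pair_symm (h : SasakiCurvature G φ ξ η D Γ) (u v w z : V) :
    G (curv D Γ u v w) z = G (curv D Γ w z u) v := by
  have cyc : ∀ a b c d, G (curv D Γ a b c) d + G (curv D Γ b c a) d + G (curv D Γ c a b) d = 0 :=
    fun a b c d => by
      have := congrArg (fun x => G x d) (curv_cyclic h.D_symm h.Γ_symm a b c)
      simpa only [map_add, add_apply, map_zero, zero_apply] using this
  have swap : ∀ a b c d, G (curv D Γ a b c) d = -G (curv D Γ b a c) d := fun a b c d => by
    rw [curv_swap, map_neg, neg_apply]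
  have h1 := cyc u v w z
  have h2 := cyc v w z u
  have h3 := cyc w z u v
  have h4 := cyc z u v w
  have s := h.curv_skew
  linarith [s u v w z, s v w u z, s w u v z, s v w z u, s w z v u, s z v w u, s w z u v,
    s z u w v, s u w z v, s z u v w, s u v z w, s v z u w, swap u v w z, swap v w u z,
    swap w u v z, swap v w z u, swap w z v u, swap z v w u, swap w z u v, swap z u w v,
    swap u w z v, swap z u v w, swap u v z w, swap v z u w]

/-- Both sides are homogeneous of degree 4, so normalizing $u$ suffices. -/
theorem quartic (h : SasakiCurvature G φ ξ η D Γ) {c : ℝ}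
    (hc : ∀ u, G u u = 1 → G u ξ = 0 → G (curv D Γ u (φ u) (φ u)) u = c) (u : V) (hu : η u = 0) :
    G (curv D Γ u (φ u) (φ u)) u = c * G u u ^ 2 := by
  by_cases hz : u = 0
  · subst hz; simp
  have hpos := h.pos u hz
  set s := Real.sqrt (G u u)
  have hs : s ^ 2 = G u u := Real.sq_sqrt hpos.le
  have hs0 : s ≠ 0 := (Real.sqrt_pos.2 hpos).ne'
  have h1 := hc (s⁻¹ • u) (by
      simp only [map_smul, smul_apply, smul_eq_mul]; rw [← hs]; field_simp)
    (by simp [h.g_ξ_right, hu])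
  simp only [map_smul, smul_apply, smul_eq_mul, curv_smul_left, curv_smul_middle,
    curv_smul_right] at h1
  rw [← hs, ← h1]
  field_simp

/-- This is half the coefficient of $t$ in the quartic identity for $u+tv$. Of the four curvature
terms in that coefficient, pair symmetry makes two equal to the other two. -/
theorem polarized (h : SasakiCurvature G φ ξ η D Γ) {c : ℝ}
    (hc : ∀ u, G u u = 1 → G u ξ = 0 → G (curv D Γ u (φ u) (φ u)) u = c) (u v : V)
    (hu : η u = 0) (hv : η v = 0) :
    G (curv D Γ u (φ u) (φ u)) v + G (curv D Γ u (φ u) (φ v)) u = 2 * c * G u u * G u v := by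
  have key : ∀ t : ℝ, _ := fun t => h.quartic hc (u + t • v) (by simp [hu, hv])
  simp only [map_add, map_smul, add_apply, smul_apply, smul_eq_mul, curv_add_left,
    curv_add_middle, curv_add_right, curv_smul_left, curv_smul_middle, curv_smul_right] at key
  -- The values at $t=\pm1,\pm2$ isolate the linear coefficient of a polynomial of degree 4.
  have k1 := key 1
  have k2 := key (-1)
  have k3 := key 2
  have k4 := key (-2)
  have p1 := h.pair_symm v (φ u) (φ u) u
  have p2 := h.pair_symm u (φ v) (φ u) u
  have p3 := h.curv_skew (φ u) u v (φ u)
  have p4 := h.curv_skew (φ u) u u (φ v)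
  have p5 : G (curv D Γ (φ u) u (φ u)) v = - G (curv D Γ u (φ u) (φ u)) v := by
    rw [curv_swap, map_neg, neg_apply]
  have p6 : G (curv D Γ (φ u) u (φ v)) u = - G (curv D Γ u (φ u) (φ v)) u := by
    rw [curv_swap, map_neg, neg_apply]
  have p7 := h.symm v u
  rw [p7] at k1 k2 k3 k4
  linarith

/-- Against horizontal $v$, the commutation rule of $R$ with $\varphi$ makes the two terms of the
polarized identity equal, so each is known. Against $\xi$, the formula for $R(\cdot,\cdot)\xi$ gives
zero. -/
theorem curv_eq (h : SasakiCurvature G φ ξ η D Γ) {c : ℝ}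
    (hc : ∀ u, G u u = 1 → G u ξ = 0 → G (curv D Γ u (φ u) (φ u)) u = c) (u : V)
    (hu : η u = 0) : curv D Γ u (φ u) (φ u) = (c * G u u) • u := by
  have horiz : ∀ v, η v = 0 → G (curv D Γ u (φ u) (φ u)) v = c * G u u * G u v := fun v hv => by
    have h1 := h.polarized hc u v hu hv
    have h2 := congrArg (fun x => G x u) (h.curv_φ u (φ u) v)
    simp only [map_add, map_sub, map_neg, map_smul, add_apply, sub_apply, neg_apply, smul_apply,
      smul_eq_mul, h.φ_sq, hu, zero_smul, add_zero, h.g_φ_self, h.g_φ_left _ u] at h2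
    have h3 := h.curv_skew u (φ u) v (φ u)
    linarith
  have vert : G (curv D Γ u (φ u) (φ u)) ξ = 0 := by
    rw [h.curv_skew, h.curv_ξ, hu, h.η_φ]; simp
  refine h.eq_of_forall fun w => ?_
  have h1 := horiz (w - η w • ξ) (by simp [h.η_ξ])
  simp only [map_sub, map_smul, smul_eq_mul, vert, mul_zero, sub_zero, h.g_ξ_right, hu] at h1
  rw [h1, map_smul, smul_apply, smul_eq_mul]

/-- On a Sasakian space form `R(u, φ u) u = -c |u|² φ u` if `u` is orthogonal to `ξ`. -/
theorem curv_eq_neg (h : SasakiCurvature G φ ξ η D Γ) {c : ℝ}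
    (hc : ∀ u, G u u = 1 → G u ξ = 0 → G (curv D Γ u (φ u) (φ u)) u = c) (u : V)
    (hu : η u = 0) : curv D Γ u (φ u) u = -((c * G u u) • φ u) := by
  have h1 := h.curv_eq hc (φ u) (h.η_φ u)
  have h2 : φ (φ u) = (-1 : ℝ) • u := by rw [h.φ_sq, hu]; simp
  rw [h.g_φ, hu, h2, curv_smul_middle, curv_smul_right, curv_swap] at h1
  rw [mul_zero, sub_zero] at h1
  rw [← h1]
  module

end SasakiCurvature
end CurvatureAlgebra

/-! ### Sasakian structures on an open set of a vector space -/

section LocalCalculus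

set_option synthInstance.maxHeartbeats 200000

variable {V : Type*} [NormedAddCommGroup V] [NormedSpace ℝ V]

/-- The tool for differentiating an identity valid on an open set: each structure equation goes
through it to become an equation between derivatives. -/
theorem hasFDerivAt_apply_eq_of_eqOn {W : Type*} [NormedAddCommGroup W] [NormedSpace ℝ W]
    {U : Set V} (hU : IsOpen U) {y : V} (hy : y ∈ U) {f g : V → W} {f' g' : V →L[ℝ] W}
    (hf : HasFDerivAt f f' y) (hg : HasFDerivAt g g' y) (hfg : ∀ z ∈ U, f z = g z) (u : V) :
    f' u = g' u := by
  have : f =ᶠ[nhds y] g := Filter.eventuallyEq_of_mem (hU.mem_nhds hy) hfg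
  rw [hf.unique (hg.congr_of_eventuallyEq this)]

/-- A normal contact metric structure on an open set of a vector space, with the Christoffel
symbols `Γ` of the Levi-Civita connection. -/
structure LocalSasaki (U : Set V) (G : V → V →L[ℝ] V →L[ℝ] ℝ) (Γ : V → V →L[ℝ] V →L[ℝ] V)
    (φ : V → V →L[ℝ] V) (ξ : V → V) (η : V → V →L[ℝ] ℝ) : Prop where
  isOpen : IsOpen U
  smooth_G : ContDiffOn ℝ ∞ G U
  smooth_Γ : ContDiffOn ℝ ∞ Γ U
  smooth_φ : ContDiffOn ℝ ∞ φ U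
  smooth_ξ : ContDiffOn ℝ ∞ ξ U
  smooth_η : ContDiffOn ℝ ∞ η U
  almostContact : ∀ y ∈ U, AlmostContactMetric (G y) (φ y) (ξ y) (η y)
  Γ_symm : ∀ y ∈ U, ∀ u v, Γ y u v = Γ y v u
  compat : ∀ y ∈ U, ∀ u v w, fderiv ℝ G y u v w = G y (Γ y u v) w + G y v (Γ y u w)
  contact : ∀ y ∈ U, ∀ u v, 2 * G y u (φ y v) = fderiv ℝ η y u v - fderiv ℝ η y v u
  normal : ∀ y ∈ U, ∀ u v, fderiv ℝ φ y (φ y u) v - fderiv ℝ φ y (φ y v) u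
    + φ y (fderiv ℝ φ y v u) - φ y (fderiv ℝ φ y u v) + (2 * G y u (φ y v)) • ξ y = 0

/-- The covariant derivative of a vector field. -/
def covField (Γ : V → V →L[ℝ] V →L[ℝ] V) (ξ : V → V) (y : V) : V →L[ℝ] V :=
  fderiv ℝ ξ y + (Γ y).flip (ξ y)

/-- The covariant derivative of a field of endomorphisms. -/
def covEndo (Γ : V → V →L[ℝ] V →L[ℝ] V) (φ : V → V →L[ℝ] V) (y : V) : V →L[ℝ] V →L[ℝ] V :=
  fderiv ℝ φ y + (ContinuousLinearMap.compL ℝ V V V).flip (φ y) ∘L Γ y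
    - ContinuousLinearMap.compL ℝ V V V (φ y) ∘L Γ y

theorem covField_apply (Γ : V → V →L[ℝ] V →L[ℝ] V) (ξ : V → V) (y u : V) :
    covField Γ ξ y u = fderiv ℝ ξ y u + Γ y u (ξ y) := rfl

theorem covEndo_apply (Γ : V → V →L[ℝ] V →L[ℝ] V) (φ : V → V →L[ℝ] V) (y u v : V) :
    covEndo Γ φ y u v = fderiv ℝ φ y u v + Γ y u (φ y v) - φ y (Γ y u v) := rfl

namespace LocalSasaki

variable {U : Set V} {G : V → V →L[ℝ] V →L[ℝ] ℝ} {Γ : V → V →L[ℝ] V →L[ℝ] V}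
  {φ : V → V →L[ℝ] V} {ξ : V → V} {η : V → V →L[ℝ] ℝ} {y : V}

theorem hasFDerivAt_of_contDiffOn {W : Type*} [NormedAddCommGroup W] [NormedSpace ℝ W]
    (hU : IsOpen U) (hy : y ∈ U) {f : V → W} (hf : ContDiffOn ℝ ∞ f U) :
    HasFDerivAt f (fderiv ℝ f y) y :=
  ((hf.contDiffAt (hU.mem_nhds hy)).differentiableAt (by simp)).hasFDerivAt

/-- The second derivative of `f` at `y`, in the directions `v` and then `u`. -/
def secondDeriv {W : Type*} [NormedAddCommGroup W] [NormedSpace ℝ W] (f : V → W) (y v : V) :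
    V →L[ℝ] W :=
  (fderiv ℝ (fderiv ℝ f) y).flip v

theorem hasFDerivAt_fderiv_apply {W : Type*} [NormedAddCommGroup W] [NormedSpace ℝ W]
    (hU : IsOpen U) (hy : y ∈ U) {f : V → W} (hf : ContDiffOn ℝ ∞ f U) (v : V) :
    HasFDerivAt (fun z => fderiv ℝ f z v) (secondDeriv f y v) y := by
  have h1 := hasFDerivAt_of_contDiffOn hU hy (hf.fderiv_of_isOpen hU (m := ∞) (by simp))
  refine (h1.clm_apply (hasFDerivAt_const v y)).congr_fderiv ?_
  ext u
  simp [secondDeriv]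

theorem secondDeriv_symm {W : Type*} [NormedAddCommGroup W] [NormedSpace ℝ W]
    (hU : IsOpen U) (hy : y ∈ U) {f : V → W} (hf : ContDiffOn ℝ ∞ f U) (u v : V) :
    secondDeriv f y v u = secondDeriv f y u v :=
  ((hf.contDiffAt (hU.mem_nhds hy)).isSymmSndFDerivAt (by simpa [minSmoothness_of_isRCLikeNormedField] using ENat.LEInfty.out)) u v

/-- Differentiate $\eta(v)=G(v,\xi)$ and express the derivative of $G$ through $\Gamma$ by metric
compatibility. -/
theorem fderiv_η (h : LocalSasaki U G Γ φ ξ η) (hy : y ∈ U) (u v : V) :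
    fderiv ℝ η y u v = η y (Γ y u v) + G y (covField Γ ξ y u) v := by
  have hG := hasFDerivAt_of_contDiffOn h.isOpen hy h.smooth_G
  have hξ := hasFDerivAt_of_contDiffOn h.isOpen hy h.smooth_ξ
  have hη := hasFDerivAt_of_contDiffOn h.isOpen hy h.smooth_η
  have h1 := hasFDerivAt_apply_eq_of_eqOn h.isOpen hy (hη.clm_apply (hasFDerivAt_const v y))
    ((hG.clm_apply (hasFDerivAt_const v y)).clm_apply hξ)
    (fun z hz => ((h.almostContact z hz).g_ξ_right v).symm) u
  have ha := h.almostContact y hy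
  simp [h.compat y hy] at h1
  rw [h1, covField_apply, ← ha.g_ξ_right, map_add, add_apply, ha.symm v, ha.symm v]
  ring

theorem sasakiDerivatives (h : LocalSasaki U G Γ φ ξ η) (hy : y ∈ U) :
    SasakiDerivatives (G y) (φ y) (ξ y) (η y) (covField Γ ξ y) (covEndo Γ φ y) := by
  have ha := h.almostContact y hy
  have hΓ := h.Γ_symm y hy
  have hG := hasFDerivAt_of_contDiffOn h.isOpen hy h.smooth_G
  have hξ := hasFDerivAt_of_contDiffOn h.isOpen hy h.smooth_ξ
  have hη := hasFDerivAt_of_contDiffOn h.isOpen hy h.smooth_η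
  have hφ := hasFDerivAt_of_contDiffOn h.isOpen hy h.smooth_φ
  have hη2 := hasFDerivAt_fderiv_apply h.isOpen hy h.smooth_η
  have cst : ∀ v : V, HasFDerivAt (fun _ : V => v) (0 : V →L[ℝ] V) y := fun v => hasFDerivAt_const v y
  refine { ha with contact := ?_, closed := ?_, normal := ?_, deriv_sq := ?_, skew := ?_, unit := ?_ }
  · intro u v
    rw [h.contact y hy, h.fderiv_η hy, h.fderiv_η hy, hΓ u v]
    ring
  -- This is $d(d\eta)=0$: in the cyclic sum of the differentiated contact equation the second
  -- derivatives of $\eta$ cancel by symmetry, and the Christoffel terms by symmetry of $\Gamma$ and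
  -- skewness of $\varphi$.
  · have key : ∀ u v w, 2 * (G y (Γ y u v) (φ y w) + G y v (Γ y u (φ y w))
        + G y v (fderiv ℝ φ y u w)) =
        secondDeriv η y v u w - secondDeriv η y w u v := fun u v w => by
      have h1 := hasFDerivAt_apply_eq_of_eqOn h.isOpen hy
        (((hG.clm_apply (cst v)).clm_apply (hφ.clm_apply (cst w))).const_mul 2)
        (((hη2 v).clm_apply (cst w)).sub
          ((hη2 w).clm_apply (cst v)))
        (fun z hz => h.contact z hz v w) u
      simp [h.compat y hy] at h1
      linarith
    intro u v w
    have k1 := key u v w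
    have k2 := key v w u
    have k3 := key w u v
    have s := secondDeriv_symm h.isOpen hy h.smooth_η
    rw [s u v] at k1
    rw [s v w] at k2
    rw [s w u] at k3
    simp only [covEndo_apply, map_sub, map_add]
    have e : ∀ a b c, G y a (φ y (Γ y b c)) = -G y (Γ y b c) (φ y a) := fun a b c => by
      rw [← ha.g_φ_left, ha.symm]
    rw [e, e, e]
    have e1 := congrArg (fun x => G y x (φ y w)) (hΓ u v)
    have e2 := congrArg (fun x => G y x (φ y u)) (hΓ v w)
    have e3 := congrArg (fun x => G y x (φ y v)) (hΓ w u)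
    linarith
  · intro u v
    have h1 := h.normal y hy u v
    simp only [covEndo_apply, map_sub, map_add]
    -- Because $\Gamma$ is symmetric, the Nijenhuis expression is the same with partial and with
    -- covariant derivatives of $\varphi$.
    rw [hΓ (φ y v) (φ y u), hΓ (φ y v) u, hΓ v (φ y u), hΓ v u, ← h1]
    abel
  · intro u v
    have h1 := hasFDerivAt_apply_eq_of_eqOn h.isOpen hy (hφ.clm_apply (hφ.clm_apply (cst v)))
      ((cst (-v)).add ((hη.clm_apply (cst v)).smul hξ))
      (fun z hz => (h.almostContact z hz).φ_sq v) u
    simp [h.fderiv_η hy] at h1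
    have h2 : fderiv ℝ φ y u (φ y v) = (η y v • fderiv ℝ ξ y u
      + (η y (Γ y u v) + G y (covField Γ ξ y u) v) • ξ y) - φ y (fderiv ℝ φ y u v) := by
      rw [← h1]; abel
    simp only [covEndo_apply, map_sub, map_add, ha.φ_sq, h2, map_neg, map_smul, covField_apply]
    module
  · intro u v w
    have h1 := hasFDerivAt_apply_eq_of_eqOn h.isOpen hy
      ((hG.clm_apply (hφ.clm_apply (cst v))).clm_apply (cst w))
      ((hG.clm_apply (cst v)).clm_apply (hφ.clm_apply (cst w))).neg
      (fun z hz => (h.almostContact z hz).g_φ_left v w) u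
    simp [h.compat y hy] at h1
    simp only [covEndo_apply, map_sub, map_add, add_apply, sub_apply, ha.g_φ_left (Γ y u v)]
    have e := ha.g_φ_left v (Γ y u w)
    linarith
  · intro u
    have h1 := hasFDerivAt_apply_eq_of_eqOn h.isOpen hy ((hG.clm_apply hξ).clm_apply hξ)
      (hasFDerivAt_const (1 : ℝ) y)
      (fun z hz => by rw [(h.almostContact z hz).g_ξ_right, (h.almostContact z hz).η_ξ]) u
    simp [h.compat y hy] at h1
    simp only [covField_apply, map_add, add_apply]
    have e := ha.symm (ξ y) (Γ y u (ξ y))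
    have e' := ha.symm (ξ y) (fderiv ℝ ξ y u)
    linarith

theorem covField_eq (h : LocalSasaki U G Γ φ ξ η) (hy : y ∈ U) (u : V) :
    fderiv ℝ ξ y u = -φ y u - Γ y u (ξ y) := by
  rw [← (h.sasakiDerivatives hy).A_eq, covField_apply, add_sub_cancel_right]

theorem covEndo_eq (h : LocalSasaki U G Γ φ ξ η) (hy : y ∈ U) (u v : V) :
    fderiv ℝ φ y u v = G y u v • ξ y - η y v • u - Γ y u (φ y v) + φ y (Γ y u v) := by
  rw [← (h.sasakiDerivatives hy).P_eq, covEndo_apply]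
  abel

/-- Differentiating the first-order equation `covEndo_eq` expresses second derivatives of $\varphi$
by first derivatives; the derivative of $\Gamma$ that appears is what produces curvature. -/
theorem secondDeriv_φ (h : LocalSasaki U G Γ φ ξ η) (hy : y ∈ U) (u v w : V) :
    secondDeriv φ y v u w =
        (G y (Γ y u v) w + G y v (Γ y u w)) • ξ y + G y v w • fderiv ℝ ξ y u
        - fderiv ℝ η y u w • v - fderiv ℝ Γ y u v (φ y w) - Γ y v (fderiv ℝ φ y u w)
        + fderiv ℝ φ y u (Γ y v w) + φ y (fderiv ℝ Γ y u v w) := by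
  have hG := hasFDerivAt_of_contDiffOn h.isOpen hy h.smooth_G
  have hξ := hasFDerivAt_of_contDiffOn h.isOpen hy h.smooth_ξ
  have hη := hasFDerivAt_of_contDiffOn h.isOpen hy h.smooth_η
  have hφ := hasFDerivAt_of_contDiffOn h.isOpen hy h.smooth_φ
  have hΓ := hasFDerivAt_of_contDiffOn h.isOpen hy h.smooth_Γ
  have hφ2 := hasFDerivAt_fderiv_apply h.isOpen hy h.smooth_φ
  have cst : ∀ v : V, HasFDerivAt (fun _ : V => v) (0 : V →L[ℝ] V) y := fun v => hasFDerivAt_const v y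
  have h1 := hasFDerivAt_apply_eq_of_eqOn h.isOpen hy
        ((hφ2 v).clm_apply (cst w))
        ((((((hG.clm_apply (cst v)).clm_apply (cst w)).smul hξ).sub
          ((hη.clm_apply (cst w)).smul (cst v))).sub
          ((hΓ.clm_apply (cst v)).clm_apply (hφ.clm_apply (cst w)))).add
          (hφ.clm_apply ((hΓ.clm_apply (cst v)).clm_apply (cst w))))
        (fun x hx => h.covEndo_eq hx v w) u
  simp only [ContinuousLinearMap.comp_zero, zero_add, ContinuousLinearMap.flip_apply,
    ContinuousLinearMap.comp_apply, add_apply, sub_apply, smul_apply,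
    ContinuousLinearMap.smulRight_apply, h.compat y hy, smul_zero] at h1
  rw [h1]; module

/-- The Ricci identity for $\varphi$: equate the two orders of its second derivative and substitute
the known first derivatives. -/
theorem curv_φ (h : LocalSasaki U G Γ φ ξ η) (hy : y ∈ U) (u v w : V) :
    curv (fderiv ℝ Γ y) (Γ y) u v (φ y w) - φ y (curv (fderiv ℝ Γ y) (Γ y) u v w) =
      -(G y v w • φ y u) + G y (φ y u) w • v + G y u w • φ y v - G y (φ y v) w • u := by
  have hΓs := h.Γ_symm y hy
  have k1 := h.secondDeriv_φ hy u v w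
  have k2 := h.secondDeriv_φ hy v u w
  rw [secondDeriv_symm h.isOpen hy h.smooth_φ, k2] at k1
  simp only [h.covField_eq hy, h.covEndo_eq hy, h.fderiv_η hy, (h.sasakiDerivatives hy).A_eq,
    map_sub, map_neg, map_add, map_smul, neg_apply] at k1
  rw [hΓs v u] at k1
  have k3 := sub_eq_zero.2 k1.symm
  simp only [curv, map_sub, map_add]
  rw [← sub_eq_zero, ← neg_zero, ← k3]
  module

theorem sasakiCurvature (h : LocalSasaki U G Γ φ ξ η) (hy : y ∈ U) :
    SasakiCurvature (G y) (φ y) (ξ y) (η y) (fderiv ℝ Γ y) (Γ y) := by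
  have ha := h.almostContact y hy
  have hΓs := h.Γ_symm y hy
  have hG := hasFDerivAt_of_contDiffOn h.isOpen hy h.smooth_G
  have hξ := hasFDerivAt_of_contDiffOn h.isOpen hy h.smooth_ξ
  have hφ := hasFDerivAt_of_contDiffOn h.isOpen hy h.smooth_φ
  have hΓ := hasFDerivAt_of_contDiffOn h.isOpen hy h.smooth_Γ
  have hG2 := hasFDerivAt_fderiv_apply h.isOpen hy h.smooth_G
  have hξ2 := hasFDerivAt_fderiv_apply h.isOpen hy h.smooth_ξ
  have cst : ∀ v : V, HasFDerivAt (fun _ : V => v) (0 : V →L[ℝ] V) y := fun v => hasFDerivAt_const v y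
  refine { ha with D_symm := ?_, Γ_symm := hΓs, curv_skew := ?_, curv_ξ := ?_, curv_φ := h.curv_φ hy }
  · intro u v w
    have h1 := hasFDerivAt_apply_eq_of_eqOn h.isOpen hy ((hΓ.clm_apply (cst v)).clm_apply (cst w))
      ((hΓ.clm_apply (cst w)).clm_apply (cst v)) (fun z hz => h.Γ_symm z hz v w) u
    simpa using h1
  -- The Ricci identity for the parallel tensor $G$ is the skew-symmetry of $R(u,v)$.
  · have key : ∀ u v w z, secondDeriv G y v u w z =
        G y (Γ y u (Γ y v w)) z + G y (Γ y v w) (Γ y u z) + G y (fderiv ℝ Γ y u v w) z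
        + G y (Γ y u w) (Γ y v z) + G y w (Γ y u (Γ y v z)) + G y w (fderiv ℝ Γ y u v z) :=
      fun u v w z => by
        have h1 := hasFDerivAt_apply_eq_of_eqOn h.isOpen hy
          (((hG2 v).clm_apply (cst w)).clm_apply (cst z))
          (((hG.clm_apply ((hΓ.clm_apply (cst v)).clm_apply (cst w))).clm_apply (cst z)).add
            ((hG.clm_apply (cst w)).clm_apply ((hΓ.clm_apply (cst v)).clm_apply (cst z))))
          (fun x hx => h.compat x hx v w z) u
        simp [h.compat y hy] at h1
        linarith
    intro u v w z
    have k1 := key u v w z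
    have k2 := key v u w z
    rw [secondDeriv_symm h.isOpen hy h.smooth_G] at k1
    rw [ha.symm _ w]
    simp only [curv, map_add, map_sub, add_apply, sub_apply]
    linarith
  -- The Ricci identity for $\xi$, from the first-order equation `covField_eq`.
  · have key : ∀ u v, secondDeriv ξ y v u = -(fderiv ℝ φ y u v)
        - fderiv ℝ Γ y u v (ξ y) - Γ y v (fderiv ℝ ξ y u) := fun u v => by
      have h1 := hasFDerivAt_apply_eq_of_eqOn h.isOpen hy (hξ2 v)
        ((hφ.clm_apply (cst v)).neg.sub ((hΓ.clm_apply (cst v)).clm_apply hξ))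
        (fun x hx => h.covField_eq hx v) u
      simp at h1
      rw [h1]; abel
    intro u v
    have k1 := key u v
    have k2 := key v u
    rw [secondDeriv_symm h.isOpen hy h.smooth_ξ, k2] at k1
    simp only [h.covField_eq hy, h.covEndo_eq hy, map_sub, map_neg] at k1
    rw [hΓs v u, ha.symm v u] at k1
    have k3 := sub_eq_zero.2 k1.symm
    simp only [curv]
    rw [← sub_eq_zero, ← neg_zero, ← k3]
    abel
end LocalSasaki
end LocalCalculus

/-! ### Christoffel symbols of a metric tensor as a smooth field of bilinear maps -/

section LeviCivita

set_option synthInstance.maxHeartbeats 200000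

variable {V : Type*} [NormedAddCommGroup V] [NormedSpace ℝ V]

/-- The combination of bilinear maps that enters the Koszul formula. -/
def koszul {W : Type*} [NormedAddCommGroup W] [NormedSpace ℝ W] (B C : V →L[ℝ] V →L[ℝ] W) :
    V →L[ℝ] V →L[ℝ] W :=
  (1 / 2 : ℝ) • (B + B.flip - C)

/-- The Christoffel symbols of the first kind, from the derivative of the metric tensor. -/
def firstKind (dG : V →L[ℝ] V →L[ℝ] V →L[ℝ] ℝ) : V →L[ℝ] V →L[ℝ] V →L[ℝ] ℝ :=
  koszul dG
    ((ContinuousLinearMap.flipₗᵢ ℝ V V ℝ).toContinuousLinearEquiv.toContinuousLinearMap ∘L dG.flip)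

theorem firstKind_apply (dG : V →L[ℝ] V →L[ℝ] V →L[ℝ] ℝ) (u v w : V) :
    firstKind dG u v w = 1 / 2 * (dG u v w + dG v u w - dG w u v) := rfl

/-- The Christoffel symbols of the second kind of the metric tensor `G`. -/
def leviCivita (G : V → V →L[ℝ] V →L[ℝ] ℝ) (y : V) : V →L[ℝ] V →L[ℝ] V :=
  ContinuousLinearMap.compL ℝ V (V →L[ℝ] ℝ) V (G y).inverse ∘L firstKind (fderiv ℝ G y)

variable {U : Set V} {G : V → V →L[ℝ] V →L[ℝ] ℝ} {y : V}

theorem leviCivita_apply (u v : V) :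
    leviCivita G y u v = (G y).inverse (firstKind (fderiv ℝ G y) u v) := rfl

theorem fderiv_symm_of_symm (hU : IsOpen U) (hG : ContDiffOn ℝ ∞ G U)
    (symm : ∀ y ∈ U, ∀ u v, G y u v = G y v u) (hy : y ∈ U) (w u v : V) :
    fderiv ℝ G y w u v = fderiv ℝ G y w v u := by
  have h := LocalSasaki.hasFDerivAt_of_contDiffOn hU hy hG
  have h1 := hasFDerivAt_apply_eq_of_eqOn hU hy
    ((h.clm_apply (hasFDerivAt_const u y)).clm_apply (hasFDerivAt_const v y))
    ((h.clm_apply (hasFDerivAt_const v y)).clm_apply (hasFDerivAt_const u y))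
    (fun z hz => symm z hz u v) w
  simpa using h1

theorem leviCivita_symm (hU : IsOpen U) (hG : ContDiffOn ℝ ∞ G U)
    (symm : ∀ y ∈ U, ∀ u v, G y u v = G y v u) (hy : y ∈ U) (u v : V) :
    leviCivita G y u v = leviCivita G y v u := by
  rw [leviCivita_apply, leviCivita_apply]
  congr 1
  ext w
  rw [firstKind_apply, firstKind_apply, fderiv_symm_of_symm hU hG symm hy w u v]
  ring

variable [FiniteDimensional ℝ V]

/-- Positivity makes $B$ injective and the dimensions agree. Hence `ContinuousLinearMap.inverse` of
the metric is a true inverse, not its default value, and depends smoothly on the point. -/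
theorem exists_equiv_of_pos {B : V →L[ℝ] V →L[ℝ] ℝ} (pos : ∀ u, u ≠ 0 → 0 < B u u) :
    ∃ e : V ≃L[ℝ] (V →L[ℝ] ℝ), (e : V →L[ℝ] V →L[ℝ] ℝ) = B := by
  have inj : Function.Injective (B : V →ₗ[ℝ] (V →L[ℝ] ℝ)) := by
    rw [← LinearMap.ker_eq_bot, LinearMap.ker_eq_bot']
    intro u hu
    by_contra hne
    have h1 := pos u hne
    have h2 : B u = 0 := hu
    rw [h2] at h1
    simp at h1
  have dim : Module.finrank ℝ V = Module.finrank ℝ (V →L[ℝ] ℝ) := by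
    rw [← (LinearMap.toContinuousLinearMap (𝕜 := ℝ) (E := V) (F' := ℝ)).finrank_eq]
    exact (Subspace.dual_finrank_eq).symm
  refine ⟨(LinearEquiv.ofInjectiveOfFinrankEq (B : V →ₗ[ℝ] (V →L[ℝ] ℝ)) inj
    dim).toContinuousLinearEquiv, ?_⟩
  ext u v
  rfl

theorem apply_leviCivita (pos : ∀ u, u ≠ 0 → 0 < G y u u) (u v w : V) :
    G y (leviCivita G y u v) w =
      1 / 2 * (fderiv ℝ G y u v w + fderiv ℝ G y v u w - fderiv ℝ G y w u v) := by
  obtain ⟨e, he⟩ := exists_equiv_of_pos pos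
  rw [leviCivita_apply, ← he, ContinuousLinearMap.inverse_equiv]
  have : (e : V →L[ℝ] V →L[ℝ] ℝ) ((e.symm : (V →L[ℝ] ℝ) →L[ℝ] V)
      (firstKind (fderiv ℝ G y) u v)) = firstKind (fderiv ℝ G y) u v := by simp
  rw [this, firstKind_apply]

theorem leviCivita_compat (hU : IsOpen U) (hG : ContDiffOn ℝ ∞ G U)
    (symm : ∀ y ∈ U, ∀ u v, G y u v = G y v u) (pos : ∀ y ∈ U, ∀ u, u ≠ 0 → 0 < G y u u)
    (hy : y ∈ U) (u v w : V) :
    fderiv ℝ G y u v w = G y (leviCivita G y u v) w + G y v (leviCivita G y u w) := by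
  rw [symm y hy v, apply_leviCivita (pos y hy), apply_leviCivita (pos y hy),
    fderiv_symm_of_symm hU hG symm hy u w v, fderiv_symm_of_symm hU hG symm hy v u w,
    fderiv_symm_of_symm hU hG symm hy w u v]
  ring

theorem contDiffOn_leviCivita (hU : IsOpen U) (hG : ContDiffOn ℝ ∞ G U)
    (pos : ∀ y ∈ U, ∀ u, u ≠ 0 → 0 < G y u u) : ContDiffOn ℝ ∞ (leviCivita G) U := by
  have dG : ∀ u v w, ContDiffOn ℝ ∞ (fun y => fderiv ℝ G y u v w) U := fun u v w =>
    (((hG.fderiv_of_isOpen hU (m := ∞) (by simp)).clm_apply contDiffOn_const).clm_apply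
      contDiffOn_const).clm_apply contDiffOn_const
  have inv : ContDiffOn ℝ ∞ (fun y => (G y).inverse) U := fun y hy => by
    obtain ⟨e, he⟩ := exists_equiv_of_pos (pos y hy)
    have h1 : ContDiffAt ℝ ∞ ContinuousLinearMap.inverse (G y) := he ▸ contDiffAt_map_inverse e
    exact h1.comp_contDiffWithinAt y (hG y hy)
  refine contDiffOn_clm_apply.2 fun u => contDiffOn_clm_apply.2 fun v => ?_
  refine inv.clm_apply (contDiffOn_clm_apply.2 fun w => ?_)
  exact contDiffOn_const.mul (((dG u v w).add (dG v u w)).sub (dG w u v))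

end LeviCivita

/-! ### Coordinate expressions of tensors and brackets -/

section Chart

theorem mem_source_symm {d : ℕ} {N : Type*} [TopologicalSpace N] [ChartedSpace (Model d) N]
    {p : N} {y : Model d}
    (hy : y ∈ (extChartAt (𝓡 d) p).target) :
    (extChartAt (𝓡 d) p).symm y ∈ (chartAt (Model d) p).source := by
  rw [← extChartAt_source (𝓡 d)]
  exact (extChartAt (𝓡 d) p).map_target hy

variable {d : ℕ} {N : Type*} [TopologicalSpace N] [ChartedSpace (Model d) N]
  [IsManifold (𝓡 d) ∞ N]

/-- The coordinate expression of a vector field in the preferred chart at `p`. -/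
def coordField (p : N) (X : ∀ x : N, TangentSpace (𝓡 d) x) (y : Model d) : Model d :=
  let x : N := (extChartAt (𝓡 d) p).symm y
  tangentToCoord p x (X x)

/-- The coordinate expression of a `1`-form in the preferred chart at `p`. -/
def coordForm (p : N) (η : ∀ x : N, TangentSpace (𝓡 d) x →L[ℝ] ℝ) (y : Model d) :
    Model d →L[ℝ] ℝ :=
  let x : N := (extChartAt (𝓡 d) p).symm y
  η x ∘L coordToTangent p x

/-- The coordinate expression of a field of endomorphisms in the preferred chart at `p`. -/
def coordEndo (p : N) (φ : ∀ x : N, TangentSpace (𝓡 d) x →L[ℝ] TangentSpace (𝓡 d) x)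
    (y : Model d) : Model d →L[ℝ] Model d :=
  let x : N := (extChartAt (𝓡 d) p).symm y
  tangentToCoord p x ∘L φ x ∘L coordToTangent p x

theorem coordToTangent_tangentToCoord {p x : N} (hx : x ∈ (chartAt (Model d) p).source)
    (v : TangentSpace (𝓡 d) x) : coordToTangent p x (tangentToCoord p x v) = v :=
  Bundle.Trivialization.symmL_continuousLinearMapAt _ hx v

theorem tangentToCoord_coordToTangent {p x : N} (hx : x ∈ (chartAt (Model d) p).source)
    (v : Model d) : tangentToCoord p x (coordToTangent p x v) = v :=
  Bundle.Trivialization.continuousLinearMapAt_symmL _ hx v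

theorem tangentToCoord_self (p : N) (v : TangentSpace (𝓡 d) p) :
    tangentToCoord p p v = (v : Model d) := by
  have h := TangentBundle.continuousLinearMapAt_trivializationAt (𝕜 := ℝ) (I := 𝓡 d)
    (mem_chart_source (Model d) p)
  rw [mfderiv_extChartAt_self] at h
  exact congrArg (fun L : Model d →L[ℝ] Model d => L v) h

theorem coordToTangent_self (p : N) (v : Model d) :
    coordToTangent p p v = (v : TangentSpace (𝓡 d) p) := by
  have h := coordToTangent_tangentToCoord (mem_chart_source (Model d) p)
    (v : TangentSpace (𝓡 d) p)
  exact (congrArg (coordToTangent p p) (tangentToCoord_self p v)).symm.trans h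

theorem tangentToCoord_eq_mfderiv {p x : N} (hx : x ∈ (chartAt (Model d) p).source)
    (v : TangentSpace (𝓡 d) x) :
    tangentToCoord p x v = (mfderiv (𝓡 d) 𝓘(ℝ, Model d) (extChartAt (𝓡 d) p) x v : Model d) := by
  have h := TangentBundle.continuousLinearMapAt_trivializationAt (𝕜 := ℝ) (I := 𝓡 d) hx
  exact congrArg (fun L : TangentSpace (𝓡 d) x →L[ℝ] Model d => L v) h

theorem contMDiffAt_extChartAt_symm {p : N} {y : Model d}
    (hy : y ∈ (extChartAt (𝓡 d) p).target) :
    ContMDiffAt 𝓘(ℝ, Model d) (𝓡 d) ∞ (extChartAt (𝓡 d) p).symm y :=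
  (contMDiffOn_extChartAt_symm p).contMDiffAt ((isOpen_extChartAt_target p).mem_nhds hy)

/-- By the chain rule for the chart composed with its inverse, this differential is a right inverse
of `tangentToCoord`. -/
theorem mfderiv_extChartAt_symm {p : N} {y : Model d}
    (hy : y ∈ (extChartAt (𝓡 d) p).target) (u : Model d) :
    mfderiv 𝓘(ℝ, Model d) (𝓡 d) (extChartAt (𝓡 d) p).symm y u =
      coordToTangent p ((extChartAt (𝓡 d) p).symm y) u := by
  have hx := mem_source_symm hy
  have h1 : MDifferentiableAt 𝓘(ℝ, Model d) (𝓡 d) (extChartAt (𝓡 d) p).symm y :=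
    (contMDiffAt_extChartAt_symm hy).mdifferentiableAt (by simp)
  have h2 : MDifferentiableAt (𝓡 d) 𝓘(ℝ, Model d) (extChartAt (𝓡 d) p)
      ((extChartAt (𝓡 d) p).symm y) := mdifferentiableAt_extChartAt hx
  have h3 := mfderiv_comp y h2 h1
  have h4 : (extChartAt (𝓡 d) p ∘ (extChartAt (𝓡 d) p).symm) =ᶠ[nhds y] id :=
    Filter.eventuallyEq_of_mem ((isOpen_extChartAt_target p).mem_nhds hy)
      (fun z hz => (extChartAt (𝓡 d) p).right_inv hz)
  rw [h4.mfderiv_eq, mfderiv_id] at h3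
  have h5 : u = tangentToCoord p _ (mfderiv 𝓘(ℝ, Model d) (𝓡 d) (extChartAt (𝓡 d) p).symm y u) := by
    rw [tangentToCoord_eq_mfderiv hx]
    exact congrArg (fun L : Model d →L[ℝ] Model d => L u) h3
  conv_rhs => rw [h5, coordToTangent_tangentToCoord hx]

theorem contMDiffAt_coordToTangent {p x : N} (hx : x ∈ (chartAt (Model d) p).source)
    (u : Model d) :
    ContMDiffAt (𝓡 d) (𝓡 d).tangent ∞
      (fun x => (⟨x, coordToTangent p x u⟩ : TangentBundle (𝓡 d) N)) x := by
  refine ((trivializationAt (Model d) (fun x : N => TangentSpace (𝓡 d) x)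
    p).contMDiffAt_section_iff (IB := 𝓡 d) hx).2 ?_
  refine (contMDiffAt_const (c := u)).congr_of_eventuallyEq ?_
  filter_upwards [(chartAt (Model d) p).open_source.mem_nhds hx] with z hz
  have h := tangentToCoord_coordToTangent hz u
  rw [tangentToCoord, Bundle.Trivialization.continuousLinearMapAt_apply,
    Bundle.Trivialization.linearMapAt_apply, if_pos (by exact hz)] at h
  exact h

theorem contMDiffAt_tangentToCoord {p x : N} (hx : x ∈ (chartAt (Model d) p).source)
    {X : ∀ x : N, TangentSpace (𝓡 d) x}
    (hX : ContMDiffAt (𝓡 d) (𝓡 d).tangent ∞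
      (fun x => (⟨x, X x⟩ : TangentBundle (𝓡 d) N)) x) :
    ContMDiffAt (𝓡 d) 𝓘(ℝ, Model d) ∞ (fun x => tangentToCoord p x (X x)) x := by
  refine (((trivializationAt (Model d) (fun x : N => TangentSpace (𝓡 d) x)
    p).contMDiffAt_section_iff (IB := 𝓡 d) hx).1 hX).congr_of_eventuallyEq ?_
  filter_upwards [(chartAt (Model d) p).open_source.mem_nhds hx] with z hz
  rw [tangentToCoord, Bundle.Trivialization.continuousLinearMapAt_apply,
    Bundle.Trivialization.linearMapAt_apply, if_pos (by exact hz)]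

theorem contDiffOn_coordField (p : N) {X : ∀ x : N, TangentSpace (𝓡 d) x}
    (hX : ∀ x ∈ (chartAt (Model d) p).source, ContMDiffAt (𝓡 d) (𝓡 d).tangent ∞
      (fun x => (⟨x, X x⟩ : TangentBundle (𝓡 d) N)) x) :
    ContDiffOn ℝ ∞ (coordField p X) (extChartAt (𝓡 d) p).target := fun y hy => by
  have hx := mem_source_symm hy
  have h := (contMDiffAt_tangentToCoord hx (hX _ hx)).comp y (contMDiffAt_extChartAt_symm hy)
  exact h.contDiffAt.contDiffWithinAt

theorem contDiffOn_coordEndo (p : N)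
    {φ : ∀ x : N, TangentSpace (𝓡 d) x →L[ℝ] TangentSpace (𝓡 d) x}
    (hφ : ContMDiff (𝓡 d) ((𝓡 d).prod 𝓘(ℝ, Model d →L[ℝ] Model d)) ∞
      (fun x => Bundle.TotalSpace.mk' (Model d →L[ℝ] Model d)
        (E := fun x : N => TangentSpace (𝓡 d) x →L[ℝ] TangentSpace (𝓡 d) x) x (φ x))) :
    ContDiffOn ℝ ∞ (coordEndo p φ) (extChartAt (𝓡 d) p).target :=
  contDiffOn_clm_apply.2 fun u => contDiffOn_coordField p fun x hx =>
    (hφ x).clm_bundle_apply (contMDiffAt_coordToTangent hx u)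

theorem contDiffOn_coordForm (p : N) {η : ∀ x : N, TangentSpace (𝓡 d) x →L[ℝ] ℝ}
    (hη : ContMDiff (𝓡 d) ((𝓡 d).prod 𝓘(ℝ, Model d →L[ℝ] ℝ)) ∞
      (fun x => Bundle.TotalSpace.mk' (Model d →L[ℝ] ℝ)
        (E := fun x : N => TangentSpace (𝓡 d) x →L[ℝ] Bundle.Trivial N ℝ x) x (η x))) :
    ContDiffOn ℝ ∞ (coordForm p η) (extChartAt (𝓡 d) p).target := by
  refine contDiffOn_clm_apply.2 fun u y hy => ?_
  have hx := mem_source_symm hy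
  have h1 := (hη _).clm_bundle_apply (contMDiffAt_coordToTangent hx u)
  have h2 := (Bundle.contMDiffAt_totalSpace.1 h1).2
  have h := ContMDiffAt.comp y h2 (contMDiffAt_extChartAt_symm hy)
  exact h.contDiffAt.contDiffWithinAt

theorem contDiffOn_metricInChart (g : Metric d N) (p : N) :
    ContDiffOn ℝ ∞ (metricInChart g p) (extChartAt (𝓡 d) p).target := by
  refine contDiffOn_clm_apply.2 fun u => contDiffOn_clm_apply.2 fun v y hy => ?_
  have hx := mem_source_symm hy
  have h1 := ContMDiffAt.clm_bundle_apply₂ (E₃ := Bundle.Trivial N ℝ) (F₁ := Model d)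
    (F₂ := Model d) (F₃ := ℝ) (g.contMDiff _)
    (contMDiffAt_coordToTangent hx u) (contMDiffAt_coordToTangent hx v)
  have h2 := (Bundle.contMDiffAt_totalSpace.1 h1).2
  have h := ContMDiffAt.comp y h2 (contMDiffAt_extChartAt_symm hy)
  exact h.contDiffAt.contDiffWithinAt

theorem metricInChart_apply (g : Metric d N) (p : N) (y u v : Model d) :
    metricInChart g p y u v = g.inner ((extChartAt (𝓡 d) p).symm y)
      (coordToTangent p _ u) (coordToTangent p _ v) := rfl

theorem metricInChart_symm (g : Metric d N) (p : N) (y u v : Model d) :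
    metricInChart g p y u v = metricInChart g p y v u := by
  rw [metricInChart_apply, metricInChart_apply, g.symm]

theorem metricInChart_pos (g : Metric d N) {p : N} {y : Model d}
    (hy : y ∈ (extChartAt (𝓡 d) p).target) (u : Model d) (hu : u ≠ 0) :
    0 < metricInChart g p y u u := by
  rw [metricInChart_apply]
  refine g.pos _ _ fun h => hu ?_
  rw [← tangentToCoord_coordToTangent (mem_source_symm hy) u, h, map_zero]

theorem mvfderiv_coordToTangent {p : N} {y : Model d} (hy : y ∈ (extChartAt (𝓡 d) p).target)
    {f : N → ℝ} (hf : MDifferentiableAt (𝓡 d) 𝓘(ℝ, ℝ) f ((extChartAt (𝓡 d) p).symm y))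
    (u : Model d) :
    mvfderiv (𝓡 d) f ((extChartAt (𝓡 d) p).symm y) (coordToTangent p _ u) =
      fderiv ℝ (fun z => f ((extChartAt (𝓡 d) p).symm z)) y u := by
  have h1 : MDifferentiableAt 𝓘(ℝ, Model d) (𝓡 d) (extChartAt (𝓡 d) p).symm y :=
    (contMDiffAt_extChartAt_symm hy).mdifferentiableAt (by simp)
  rw [← mfderiv_extChartAt_symm hy]
  have h2 := mfderiv_comp y hf h1
  rw [mfderiv_eq_fderiv] at h2
  exact (congrArg (fun L : Model d →L[ℝ] ℝ => L u) h2).symm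

/-- Naturality of the bracket under pullback by the inverse chart, the pullback of a field being its
coordinate expression. -/
theorem tangentToCoord_mlieBracket {p : N} {y : Model d}
    (hy : y ∈ (extChartAt (𝓡 d) p).target) {X Y : ∀ x : N, TangentSpace (𝓡 d) x}
    (hX : IsSmoothField X) (hY : IsSmoothField Y) :
    tangentToCoord p ((extChartAt (𝓡 d) p).symm y) (VectorField.mlieBracket (𝓡 d) X Y _) =
      VectorField.lieBracket ℝ (coordField p X) (coordField p Y) y := by
  have pull : ∀ Z : ∀ x : N, TangentSpace (𝓡 d) x, ∀ z ∈ (extChartAt (𝓡 d) p).target,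
      VectorField.mpullback 𝓘(ℝ, Model d) (𝓡 d) (extChartAt (𝓡 d) p).symm Z z =
        coordField p Z z := fun Z z hz => by
    have hx := mem_source_symm hz
    rw [VectorField.mpullback_apply]
    have h1 : (mfderiv 𝓘(ℝ, Model d) (𝓡 d) (extChartAt (𝓡 d) p).symm z).inverse =
        tangentToCoord p ((extChartAt (𝓡 d) p).symm z) := by
      refine ContinuousLinearMap.inverse_eq ?_ ?_
      · ext v
        exact (mfderiv_extChartAt_symm hz _).trans (coordToTangent_tangentToCoord hx v)
      · ext1 v
        refine Eq.trans ?_ (tangentToCoord_coordToTangent hx v)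
        exact congrArg _ (mfderiv_extChartAt_symm hz v)
    rw [h1]
    rfl
  have : IsManifold (𝓡 d) (minSmoothness ℝ 2) N := by
    rw [minSmoothness_of_isRCLikeNormedField]
    exact IsManifold.of_le (n := ∞) ENat.LEInfty.out
  have : IsManifold 𝓘(ℝ, Model d) (minSmoothness ℝ 2) (Model d) := by
    infer_instance
  have h := VectorField.mpullback_mlieBracket (n := ∞) (V := X) (W := Y)
    ((hX _).mdifferentiableAt (by simp)) ((hY _).mdifferentiableAt (by simp))
    (contMDiffAt_extChartAt_symm hy)
    (by rw [minSmoothness_of_isRCLikeNormedField]; exact ENat.LEInfty.out)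
  rw [pull _ y hy] at h
  refine h.trans ?_
  rw [← VectorField.mlieBracketWithin_univ, VectorField.mlieBracketWithin_eq_lieBracketWithin]
  refine (congrFun VectorField.lieBracketWithin_univ y).trans ?_
  have ev : ∀ Z, VectorField.mpullback 𝓘(ℝ, Model d) (𝓡 d) (extChartAt (𝓡 d) p).symm Z
      =ᶠ[nhds y] coordField p Z := fun Z =>
    Filter.eventuallyEq_of_mem ((isOpen_extChartAt_target p).mem_nhds hy) (pull Z)
  exact (ev X).lieBracket_vectorField_eq (ev Y)

end Chart

/-! ### Extending constant coordinate fields to the whole manifold -/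

section Extension

variable {d : ℕ} {N : Type*} [TopologicalSpace N] [ChartedSpace (Model d) N]
  [IsManifold (𝓡 d) ∞ N]

theorem coordField_apply_endo {p : N} {y : Model d} (hy : y ∈ (extChartAt (𝓡 d) p).target)
    (φ : ∀ x : N, TangentSpace (𝓡 d) x →L[ℝ] TangentSpace (𝓡 d) x)
    (X : ∀ x : N, TangentSpace (𝓡 d) x) :
    coordField p (fun x => φ x (X x)) y = coordEndo p φ y (coordField p X y) := by
  have h := coordToTangent_tangentToCoord (mem_source_symm hy) (X ((extChartAt (𝓡 d) p).symm y))
  exact congrArg (fun v => tangentToCoord p _ (φ _ v)) h.symm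

/-- Near `p`, the constant vector fields of the preferred chart at `p` are restrictions of global
smooth vector fields. -/
theorem exists_isSmoothField_eq_coordToTangent [T2Space N] (p : N) :
    ∃ U : Set (Model d), IsOpen U ∧ U ⊆ (extChartAt (𝓡 d) p).target ∧
      extChartAt (𝓡 d) p p ∈ U ∧ ∀ u : Model d, ∃ X : ∀ x : N, TangentSpace (𝓡 d) x,
        IsSmoothField X ∧ ∀ y ∈ U, coordField p X y = u := by
  obtain ⟨f⟩ : Nonempty (SmoothBumpFunction (𝓡 d) p) := inferInstance
  have h1 : ∀ᶠ y in nhds (extChartAt (𝓡 d) p p), f ((extChartAt (𝓡 d) p).symm y) = 1 := by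
    have h2 := (continuousAt_extChartAt_symm (I := 𝓡 d) p).tendsto
    rw [extChartAt_to_inv] at h2
    exact h2.eventually f.eventuallyEq_one
  obtain ⟨U, hU, hUo, hpU⟩ := eventually_nhds_iff.1
    (h1.and ((isOpen_extChartAt_target (I := 𝓡 d) p).mem_nhds (mem_extChartAt_target p)))
  refine ⟨U, hUo, fun y hy => (hU y hy).2, hpU, fun u => ?_⟩
  -- The bump function has its support in the chart domain, so the product extends smoothly by zero;
  -- it equals 1 on the image of `U`.
  refine ⟨fun x => f x • coordToTangent p x u, fun x => ?_, fun y hy => ?_⟩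
  · by_cases hx : x ∈ tsupport f
    · exact ContMDiffAt.smul_section f.contMDiffAt
        (contMDiffAt_coordToTangent (f.tsupport_subset_chartAt_source hx) u)
    · refine (Bundle.contMDiffAt_zeroSection ℝ
        (fun x : N => TangentSpace (𝓡 d) x)).congr_of_eventuallyEq ?_
      filter_upwards [(isClosed_tsupport f).isOpen_compl.mem_nhds hx] with z hz
      have : f z = 0 := image_eq_zero_of_notMem_tsupport hz
      simp [Bundle.zeroSection, this]
  · have h3 : coordField p (fun x => f x • coordToTangent p x u) y =
        f ((extChartAt (𝓡 d) p).symm y) • u := by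
      rw [coordField, map_smul, tangentToCoord_coordToTangent (mem_source_symm (hU y hy).2)]
    rw [h3, (hU y hy).1, one_smul]

end Extension

/-! ### From the global structure to its local form in a chart -/

namespace ContactMetricStructure

variable {n : ℕ} {N : Type*} [TopologicalSpace N] [ChartedSpace (Model (2 * n + 1)) N]
  [IsManifold (𝓡 (2 * n + 1)) ∞ N]

theorem isSmoothField_φ (S : ContactMetricStructure n N)
    {X : ∀ x : N, TangentSpace (𝓡 (2 * n + 1)) x} (hX : IsSmoothField X) :
    IsSmoothField (fun x => S.φ x (X x)) := fun x => (S.smooth_φ x).clm_bundle_apply (hX x)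

theorem mdifferentiable_η (S : ContactMetricStructure n N)
    {X : ∀ x : N, TangentSpace (𝓡 (2 * n + 1)) x} (hX : IsSmoothField X) (x : N) :
    MDifferentiableAt (𝓡 (2 * n + 1)) 𝓘(ℝ, ℝ) (fun x => S.η x (X x)) x := by
  have h1 := (S.smooth_η x).clm_bundle_apply (hX x)
  have h2 : ContMDiffAt (𝓡 (2 * n + 1)) 𝓘(ℝ, ℝ) ∞ (fun x => S.η x (X x)) x :=
    (Bundle.contMDiffAt_totalSpace.1 h1).2
  exact h2.mdifferentiableAt (by simp)

theorem almostContactMetric_coord (S : ContactMetricStructure n N) {p : N}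
    {y : Model (2 * n + 1)} (hy : y ∈ (extChartAt (𝓡 (2 * n + 1)) p).target) :
    AlmostContactMetric (metricInChart S.g p y) (coordEndo p S.φ y) (coordField p S.ξ y)
      (coordForm p S.η y) := by
  have hx := mem_source_symm hy
  have inv := fun v => coordToTangent_tangentToCoord hx v
  refine ⟨metricInChart_symm S.g p y, metricInChart_pos S.g hy, fun v => ?_, ?_, fun u v => ?_⟩
  · have h1 : coordEndo p S.φ y (coordEndo p S.φ y v) = tangentToCoord p _
        (S.φ _ (S.φ _ (coordToTangent p _ v))) :=
      congrArg (fun w => tangentToCoord p _ (S.φ _ w)) (inv _)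
    rw [h1, S.φ_sq, map_add, map_neg, map_smul, tangentToCoord_coordToTangent hx]
    rfl
  · have h1 : coordForm p S.η y (coordField p S.ξ y) = S.η _ (S.ξ _) := congrArg (S.η _) (inv _)
    rw [h1, S.η_ξ]
  · have h1 : metricInChart S.g p y (coordEndo p S.φ y u) (coordEndo p S.φ y v) =
        S.g.inner _ (S.φ _ (coordToTangent p _ u)) (S.φ _ (coordToTangent p _ v)) :=
      congrArg₂ (fun a b => S.g.inner _ a b) (inv _) (inv _)
    rw [h1, S.g_φ]
    rfl

/-- A Sasakian structure in the preferred chart at `p`, near `p`. -/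
theorem exists_localSasaki [T2Space N] (S : ContactMetricStructure n N) (hS : S.IsSasakian)
    (p : N) : ∃ U : Set (Model (2 * n + 1)), U ⊆ (extChartAt (𝓡 (2 * n + 1)) p).target ∧
      extChartAt (𝓡 (2 * n + 1)) p p ∈ U ∧
      LocalSasaki U (metricInChart S.g p) (leviCivita (metricInChart S.g p)) (coordEndo p S.φ)
        (coordField p S.ξ) (coordForm p S.η) := by
  obtain ⟨U, hU, hUt, hpU, hX⟩ := exists_isSmoothField_eq_coordToTangent (d := 2 * n + 1) p
  choose X hXs hX using hX
  have hG := (contDiffOn_metricInChart S.g p).mono hUt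
  have hφ := (contDiffOn_coordEndo p S.smooth_φ).mono hUt
  have hη := (contDiffOn_coordForm p S.smooth_η).mono hUt
  have hpos : ∀ y ∈ U, ∀ u, u ≠ 0 → 0 < metricInChart S.g p y u u :=
    fun y hy => metricInChart_pos S.g (hUt hy)
  have hsymm : ∀ y ∈ U, ∀ u v, metricInChart S.g p y u v = metricInChart S.g p y v u :=
    fun y _ => metricInChart_symm S.g p y
  have ev : ∀ u, ∀ y ∈ U, coordField p (X u) =ᶠ[nhds y] fun _ => u := fun u y hy =>
    Filter.eventuallyEq_of_mem (hU.mem_nhds hy) (hX u)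
  have evφ : ∀ u, ∀ y ∈ U, coordField p (fun x => S.φ x (X u x)) =ᶠ[nhds y]
      fun z => coordEndo p S.φ z u := fun u y hy => by
    filter_upwards [hU.mem_nhds hy] with z hz
    rw [coordField_apply_endo (hUt hz), hX u z hz]
  have Xeq : ∀ u, ∀ y ∈ U, X u ((extChartAt (𝓡 (2 * n + 1)) p).symm y) =
      coordToTangent p _ u := fun u y hy => by
    conv_rhs => rw [← hX u y hy]
    exact (coordToTangent_tangentToCoord (mem_source_symm (hUt hy)) _).symm
  have evη : ∀ u, ∀ y ∈ U, (fun z => S.η ((extChartAt (𝓡 (2 * n + 1)) p).symm z)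
      (X u ((extChartAt (𝓡 (2 * n + 1)) p).symm z))) =ᶠ[nhds y]
      fun z => coordForm p S.η z u := fun u y hy => by
    filter_upwards [hU.mem_nhds hy] with z hz
    rw [Xeq u z hz]
    rfl
  -- The extended fields are constant in the chart, so the bracket term vanishes and only partial
  -- derivatives of $\eta$ survive.
  have dη : ∀ y ∈ U, ∀ u v, extDerivForm S.η (X u) (X v) ((extChartAt (𝓡 (2 * n + 1)) p).symm y) =
      1 / 2 * (fderiv ℝ (coordForm p S.η) y u v - fderiv ℝ (coordForm p S.η) y v u) := by
    intro y hy u v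
    have hx := mem_source_symm (hUt hy)
    have br : VectorField.mlieBracket (𝓡 (2 * n + 1)) (X u) (X v)
        ((extChartAt (𝓡 (2 * n + 1)) p).symm y) = 0 := by
      rw [← coordToTangent_tangentToCoord hx (VectorField.mlieBracket _ _ _ _),
        tangentToCoord_mlieBracket (hUt hy) (hXs u) (hXs v),
        (ev u y hy).lieBracket_vectorField_eq (ev v y hy)]
      have : VectorField.lieBracket ℝ (fun _ : Model (2 * n + 1) => u) (fun _ => v) y = 0 := by
        simp [VectorField.lieBracket_eq]
      rw [this, map_zero]
    have der : ∀ u v, mvfderiv (𝓡 (2 * n + 1)) (fun x => S.η x (X v x))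
        ((extChartAt (𝓡 (2 * n + 1)) p).symm y)
        (X u ((extChartAt (𝓡 (2 * n + 1)) p).symm y)) =
          fderiv ℝ (coordForm p S.η) y u v := fun u v => by
      rw [Xeq u y hy, mvfderiv_coordToTangent (hUt hy) (S.mdifferentiable_η (hXs v) _),
        (evη v y hy).fderiv_eq]
      have h1 := (LocalSasaki.hasFDerivAt_of_contDiffOn hU hy hη).clm_apply
        (hasFDerivAt_const v y)
      rw [h1.fderiv]
      simp
    rw [extDerivForm, der, der, br, map_zero, sub_zero]
  have gφ : ∀ y ∈ U, ∀ u v, S.g.inner ((extChartAt (𝓡 (2 * n + 1)) p).symm y) (X u _)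
      (S.φ _ (X v _)) = metricInChart S.g p y u (coordEndo p S.φ y v) := fun y hy u v => by
    have hx := mem_source_symm (hUt hy)
    rw [Xeq u y hy, Xeq v y hy, metricInChart_apply]
    exact congrArg (S.g.inner _ _) (coordToTangent_tangentToCoord hx _).symm
  refine ⟨U, hUt, hpU, ?_⟩
  refine ⟨hU, hG, contDiffOn_leviCivita hU hG hpos, hφ,
    (contDiffOn_coordField p fun x _ => S.smooth_ξ x).mono hUt, hη,
    fun y hy => S.almostContactMetric_coord (hUt hy), fun y hy => leviCivita_symm hU hG hsymm hy,
    fun y hy => leviCivita_compat hU hG hsymm hpos hy, fun y hy u v => ?_, fun y hy u v => ?_⟩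
  · rw [← gφ y hy, S.g_dη _ _ (hXs u) (hXs v), dη y hy]
    ring
  · have hx := mem_source_symm (hUt hy)
    have h1 := hS (X u) (X v) (hXs u) (hXs v) ((extChartAt (𝓡 (2 * n + 1)) p).symm y)
    rw [← S.g_dη _ _ (hXs u) (hXs v), gφ y hy] at h1
    have h2 := congrArg (tangentToCoord p _) h1
    have φcoord : ∀ v, tangentToCoord p ((extChartAt (𝓡 (2 * n + 1)) p).symm y) (S.φ _ v) =
        coordEndo p S.φ y (tangentToCoord p _ v) := fun v =>
      congrArg (fun w => tangentToCoord p _ (S.φ _ w)) (coordToTangent_tangentToCoord hx v).symm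
    have dφ : ∀ u w, fderiv ℝ (fun z => coordEndo p S.φ z u) y w =
        fderiv ℝ (coordEndo p S.φ) y w u := fun u w => by
      have h1 := (LocalSasaki.hasFDerivAt_of_contDiffOn hU hy hφ).clm_apply
        (hasFDerivAt_const u y)
      rw [h1.fderiv]
      simp
    -- Near `y` the fields are $u$, $v$, $\varphi u$, $\varphi v$ with $u,v$ constant, so every
    -- bracket in $N_\varphi$ becomes a combination of derivatives of $\varphi$.
    rw [map_add, map_smul, map_zero, nijenhuis, map_add, map_sub, map_sub, φcoord, φcoord, φcoord,
      φcoord, tangentToCoord_mlieBracket (hUt hy) (S.isSmoothField_φ (hXs u))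
        (S.isSmoothField_φ (hXs v)),
      tangentToCoord_mlieBracket (hUt hy) (S.isSmoothField_φ (hXs u)) (hXs v),
      tangentToCoord_mlieBracket (hUt hy) (hXs u) (S.isSmoothField_φ (hXs v)),
      tangentToCoord_mlieBracket (hUt hy) (hXs u) (hXs v),
      (evφ u y hy).lieBracket_vectorField_eq (evφ v y hy),
      (evφ u y hy).lieBracket_vectorField_eq (ev v y hy),
      (ev u y hy).lieBracket_vectorField_eq (evφ v y hy),
      (ev u y hy).lieBracket_vectorField_eq (ev v y hy)] at h2
    simp only [VectorField.lieBracket_eq, dφ] at h2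
    simp at h2
    rw [← h2]
    rfl

end ContactMetricStructure

theorem hasDerivAt_endo_apply {V : Type*} [NormedAddCommGroup V] [NormedSpace ℝ V]
    {Φ : V → V →L[ℝ] V} {Φ' : V →L[ℝ] V →L[ℝ] V} {c v : ℝ → V} {c' v' : V} {t : ℝ}
    (hΦ : HasFDerivAt Φ Φ' (c t)) (hc : HasDerivAt c c' t) (hv : HasDerivAt v v' t) :
    HasDerivAt (fun s => Φ (c s) (v s)) (Φ' c' (v t) + Φ (c t) v') t :=
  (hΦ.comp_hasDerivAt t hc).clm_apply hv

/-! ### Tensors at the centre of a chart, and calculus along a curve -/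

section Along

theorem eventually_mem_source {d : ℕ} {N : Type*} [TopologicalSpace N] [ChartedSpace (Model d) N]
    {γ : ℝ → N} {t : ℝ} (hγ : ContMDiffAt 𝓘(ℝ, ℝ) (𝓡 d) ∞ γ t) :
    ∀ᶠ s in nhds t, γ s ∈ (chartAt (Model d) (γ t)).source :=
  hγ.continuousAt ((chartAt (Model d) (γ t)).open_source.mem_nhds
    (mem_chart_source (Model d) (γ t)))

variable {d : ℕ} {N : Type*} [TopologicalSpace N] [ChartedSpace (Model d) N]
  [IsManifold (𝓡 d) ∞ N]

theorem metricInChart_center (g : Metric d N) (p : N) :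
    metricInChart g p (extChartAt (𝓡 d) p p) =
      (show Model d →L[ℝ] Model d →L[ℝ] ℝ from g.inner p) := by
  ext1 u
  ext1 v
  refine (congrArg (fun x => g.inner x (coordToTangent p x u) (coordToTangent p x v))
    (extChartAt_to_inv (I := 𝓡 d) p)).trans ?_
  exact congrArg₂ (fun a b => g.inner p a b) (coordToTangent_self p u) (coordToTangent_self p v)

theorem coordField_center (p : N) (X : ∀ x : N, TangentSpace (𝓡 d) x) :
    coordField p X (extChartAt (𝓡 d) p p) = (show Model d from X p) :=
  (congrArg (fun x => tangentToCoord p x (X x)) (extChartAt_to_inv (I := 𝓡 d) p)).trans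
    (tangentToCoord_self p _)

theorem coordForm_center (p : N) (η : ∀ x : N, TangentSpace (𝓡 d) x →L[ℝ] ℝ) :
    coordForm p η (extChartAt (𝓡 d) p p) = (show Model d →L[ℝ] ℝ from η p) := by
  ext1 u
  exact (congrArg (fun x => η x (coordToTangent p x u)) (extChartAt_to_inv (I := 𝓡 d) p)).trans
    (congrArg (η p) (coordToTangent_self p u))

theorem coordEndo_center (p : N)
    (φ : ∀ x : N, TangentSpace (𝓡 d) x →L[ℝ] TangentSpace (𝓡 d) x) :
    coordEndo p φ (extChartAt (𝓡 d) p p) = (show Model d →L[ℝ] Model d from φ p) := by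
  ext1 u
  exact (congrArg (fun x => tangentToCoord p x (φ x (coordToTangent p x u)))
    (extChartAt_to_inv (I := 𝓡 d) p)).trans
    ((tangentToCoord_self p _).trans (congrArg (φ p) (coordToTangent_self p u)))

-- `leviCivita` unfolds to `christoffel`; its differentiability at the centre allows fixing two
-- arguments before or after differentiating.
set_option synthInstance.maxHeartbeats 200000 in
theorem curvature_eq (g : Metric d N) (p : N) (u v w : Model d) :
    curvature g p u v w =
      curv (fderiv ℝ (leviCivita (metricInChart g p)) (extChartAt (𝓡 d) p p))
        (leviCivita (metricInChart g p) (extChartAt (𝓡 d) p p)) u v w := by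
  have hU := isOpen_extChartAt_target (I := 𝓡 d) p
  have hΓ := LocalSasaki.hasFDerivAt_of_contDiffOn hU (mem_extChartAt_target p)
    (contDiffOn_leviCivita hU (contDiffOn_metricInChart g p) fun y hy => metricInChart_pos g hy)
  have h1 : ∀ a b c : Model d, fderiv ℝ (fun y => leviCivita (metricInChart g p) y a b)
      (extChartAt (𝓡 d) p p) c =
      fderiv ℝ (leviCivita (metricInChart g p)) (extChartAt (𝓡 d) p p) c a b := fun a b c => by
    rw [((hΓ.clm_apply (hasFDerivAt_const a _)).clm_apply (hasFDerivAt_const b _)).fderiv]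
    simp
  rw [curv, ← h1, ← h1]
  rfl

theorem curvature_smul_middle (g : Metric d N) (p : N) (a : ℝ) (u v w : TangentSpace (𝓡 d) p) :
    curvature g p u (a • v) w = a • curvature g p u v w :=
  (curvature_eq g p _ _ _).trans ((curv_smul_middle _ _ a (show Model d from u) v w).trans
    (congrArg (fun x : Model d => a • x) (curvature_eq g p _ _ _).symm))

theorem curvature_zero_middle (g : Metric d N) (p : N) (u w : TangentSpace (𝓡 d) p) :
    curvature g p u 0 w = 0 := by
  simpa using curvature_smul_middle g p 0 u 0 w

/-- The coordinates, in the preferred chart at `γ t`, of a vector field along a curve. -/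
def coordAlong (γ : ℝ → N) (V : ∀ t, TangentSpace (𝓡 d) (γ t)) (t s : ℝ) : Model d :=
  tangentToCoord (γ t) (γ s) (V s)

/-- Differentiability of a vector field along a curve. -/
def DiffAlongAt (γ : ℝ → N) (V : ∀ t, TangentSpace (𝓡 d) (γ t)) (t : ℝ) : Prop :=
  DifferentiableAt ℝ (coordAlong γ V t) t

variable {γ : ℝ → N} {V W : ∀ t, TangentSpace (𝓡 d) (γ t)} {t : ℝ}

theorem coordAlong_self : coordAlong γ V t t = (V t : Model d) := tangentToCoord_self _ _

theorem covDerivAlong_eq (g : Metric d N) :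
    covDerivAlong g γ V t = (deriv (coordAlong γ V t) t +
      leviCivita (metricInChart g (γ t)) (extChartAt (𝓡 d) (γ t) (γ t)) (velocity γ t) (V t) :
        Model d) := rfl

theorem coordAlong_congr (h : ∀ᶠ s in nhds t, V s = W s) :
    coordAlong γ V t =ᶠ[nhds t] coordAlong γ W t := by
  filter_upwards [h] with s hs
  rw [coordAlong, coordAlong, hs]

theorem DiffAlongAt.congr (hV : DiffAlongAt γ V t) (h : ∀ᶠ s in nhds t, V s = W s) :
    DiffAlongAt γ W t :=
  DifferentiableAt.congr_of_eventuallyEq hV (coordAlong_congr h).symm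

theorem covDerivAlong_congr (g : Metric d N) (h : ∀ᶠ s in nhds t, V s = W s) :
    covDerivAlong g γ V t = covDerivAlong g γ W t := by
  rw [covDerivAlong_eq, covDerivAlong_eq, (coordAlong_congr h).deriv_eq, h.self_of_nhds]

theorem covDerivAlong_zero (g : Metric d N) :
    covDerivAlong g γ (fun s => (0 : TangentSpace (𝓡 d) (γ s))) t = 0 := by
  have h1 : coordAlong γ (fun s => (0 : TangentSpace (𝓡 d) (γ s))) t = fun _ => 0 := by
    funext s
    exact map_zero _
  rw [covDerivAlong_eq, h1, deriv_const]
  exact (zero_add _).trans (map_zero _)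

theorem coordAlong_add : coordAlong γ (fun s => V s + W s) t =
    coordAlong γ V t + coordAlong γ W t := by
  funext s
  exact map_add _ _ _

theorem coordAlong_smul (f : ℝ → ℝ) : coordAlong γ (fun s => f s • V s) t =
    fun s => f s • coordAlong γ V t s := by
  funext s
  exact map_smul _ _ _

theorem DiffAlongAt.add (hV : DiffAlongAt γ V t) (hW : DiffAlongAt γ W t) :
    DiffAlongAt γ (fun s => V s + W s) t := by
  rw [DiffAlongAt, coordAlong_add]
  exact DifferentiableAt.add hV hW

theorem DiffAlongAt.smul {f : ℝ → ℝ} (hf : DifferentiableAt ℝ f t) (hV : DiffAlongAt γ V t) :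
    DiffAlongAt γ (fun s => f s • V s) t := by
  rw [DiffAlongAt, coordAlong_smul]
  exact DifferentiableAt.smul hf hV

theorem covDerivAlong_add (g : Metric d N) (hV : DiffAlongAt γ V t) (hW : DiffAlongAt γ W t) :
    covDerivAlong g γ (fun s => V s + W s) t = covDerivAlong g γ V t + covDerivAlong g γ W t := by
  have key : ∀ (L : Model d →L[ℝ] Model d) (a b v w : Model d),
      a + b + L (v + w) = a + L v + (b + L w) := fun L a b v w => by
    rw [map_add]; abel
  rw [covDerivAlong_eq, covDerivAlong_eq, covDerivAlong_eq, coordAlong_add, deriv_add hV hW]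
  exact key (leviCivita (metricInChart g (γ t)) (extChartAt (𝓡 d) (γ t) (γ t)) (velocity γ t)) _ _
    (V t) (W t)

theorem covDerivAlong_smul (g : Metric d N) {f : ℝ → ℝ} (hf : DifferentiableAt ℝ f t)
    (hV : DiffAlongAt γ V t) :
    covDerivAlong g γ (fun s => f s • V s) t = deriv f t • V t + f t • covDerivAlong g γ V t := by
  have key : ∀ (L : Model d →L[ℝ] Model d) (a b : ℝ) (v w : Model d),
      (a • w + b • v) + L (a • v) = b • v + a • (w + L v) := fun L a b v w => by
    rw [map_smul]; module
  rw [covDerivAlong_eq, covDerivAlong_eq, coordAlong_smul, deriv_fun_smul hf hV, coordAlong_self]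
  exact key (leviCivita (metricInChart g (γ t)) (extChartAt (𝓡 d) (γ t) (γ t)) (velocity γ t))
    (f t) (deriv f t) (V t) _

theorem diffAlongAt_of_contMDiffAt
    (h : ContMDiffAt 𝓘(ℝ, ℝ) (𝓡 d).tangent ∞
      (fun t => (⟨γ t, V t⟩ : TangentBundle (𝓡 d) N)) t) : DiffAlongAt γ V t := by
  obtain ⟨h1, h2⟩ := Bundle.contMDiffAt_totalSpace.1 h
  refine (h2.contDiffAt.differentiableAt (by simp)).congr_of_eventuallyEq ?_
  filter_upwards [h1.continuousAt ((chartAt (Model d) (γ t)).open_source.mem_nhds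
    (mem_chart_source (Model d) (γ t)))] with s hs
  rw [coordAlong, tangentToCoord, Bundle.Trivialization.continuousLinearMapAt_apply,
    Bundle.Trivialization.linearMapAt_apply, if_pos (by exact hs)]

theorem hasDerivAt_extChartAt_comp (hγ : ContMDiffAt 𝓘(ℝ, ℝ) (𝓡 d) ∞ γ t) :
    HasDerivAt (fun s => extChartAt (𝓡 d) (γ t) (γ s)) (velocity γ t : Model d) t := by
  have h1 : MDifferentiableAt 𝓘(ℝ, ℝ) (𝓡 d) γ t := hγ.mdifferentiableAt (by simp)
  have h2 : MDifferentiableAt (𝓡 d) 𝓘(ℝ, Model d) (extChartAt (𝓡 d) (γ t)) (γ t) :=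
    mdifferentiableAt_extChartAt (mem_chart_source _ _)
  have h3 := mfderiv_comp t h2 h1
  rw [mfderiv_eq_fderiv, mfderiv_extChartAt_self] at h3
  have h4 : DifferentiableAt ℝ (extChartAt (𝓡 d) (γ t) ∘ γ) t :=
    (h2.comp t h1).differentiableAt
  have h5 := h4.hasFDerivAt.hasDerivAt
  have h6 : fderiv ℝ (extChartAt (𝓡 d) (γ t) ∘ γ) t 1 = (velocity γ t : Model d) :=
    congrArg (fun L : ℝ →L[ℝ] Model d => L 1) h3
  rw [h6] at h5
  exact h5

end Along

/-! ### Sasakian identities along a curve and for the curvature -/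

namespace ContactMetricStructure

variable {n : ℕ} {N : Type*} [TopologicalSpace N] [ChartedSpace (Model (2 * n + 1)) N]
  [IsManifold (𝓡 (2 * n + 1)) ∞ N] [T2Space N]
  {γ : ℝ → N} {V : ∀ t, TangentSpace (𝓡 (2 * n + 1)) (γ t)} {t : ℝ}

omit [T2Space N] in
theorem almostContactMetric (S : ContactMetricStructure n N) (x : N) :
    AlmostContactMetric (V := Model (2 * n + 1)) (S.g.inner x) (S.φ x) (S.ξ x) (S.η x) where
  symm := S.g.symm x
  pos := S.g.pos x
  φ_sq := S.φ_sq x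
  η_ξ := S.η_ξ x
  g_φ := S.g_φ x

theorem covDerivAlong_ξ (S : ContactMetricStructure n N) (hS : S.IsSasakian)
    (hγ : ContMDiffAt 𝓘(ℝ, ℝ) (𝓡 (2 * n + 1)) ∞ γ t) :
    covDerivAlong S.g γ (fun s => S.ξ (γ s)) t = -S.φ (γ t) (velocity γ t) := by
  obtain ⟨U, hUt, hpU, hloc⟩ := S.exists_localSasaki hS (γ t)
  have hc := hasDerivAt_extChartAt_comp hγ
  have hξ := LocalSasaki.hasFDerivAt_of_contDiffOn hloc.isOpen hpU hloc.smooth_ξ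
  have h1 : coordAlong γ (fun s => S.ξ (γ s)) t =ᶠ[nhds t]
      fun s => coordField (γ t) S.ξ (extChartAt (𝓡 (2 * n + 1)) (γ t) (γ s)) := by
    filter_upwards [eventually_mem_source hγ] with s hs
    have h2 := (extChartAt (𝓡 (2 * n + 1)) (γ t)).left_inv (by rwa [extChartAt_source])
    exact (congrArg (fun x => tangentToCoord (γ t) x (S.ξ x)) h2).symm
  have h2 := (hξ.comp_hasDerivAt t hc).congr_of_eventuallyEq h1
  have h3 := hloc.covField_eq hpU (velocity γ t)
  rw [coordEndo_center, coordField_center] at h3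
  rw [covDerivAlong_eq, h2.deriv, h3]
  exact sub_add_cancel _ _

omit [T2Space N] in
theorem coordAlong_φ (S : ContactMetricStructure n N)
    (hγ : ContMDiffAt 𝓘(ℝ, ℝ) (𝓡 (2 * n + 1)) ∞ γ t) :
    coordAlong γ (fun s => S.φ (γ s) (V s)) t =ᶠ[nhds t]
      fun s => coordEndo (γ t) S.φ (extChartAt (𝓡 (2 * n + 1)) (γ t) (γ s))
        (coordAlong γ V t s) := by
  filter_upwards [eventually_mem_source hγ] with s hs
  have h2 := (extChartAt (𝓡 (2 * n + 1)) (γ t)).left_inv (by rwa [extChartAt_source])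
  refine Eq.trans ?_ (congrArg (fun x => tangentToCoord (γ t) x
    (S.φ x (coordToTangent (γ t) x (coordAlong γ V t s)))) h2).symm
  exact congrArg (fun v => tangentToCoord (γ t) (γ s) (S.φ (γ s) v))
    (coordToTangent_tangentToCoord hs (V s)).symm

/-- Leibniz rule $\nabla_T(\varphi V)=(\nabla_T\varphi)V+\varphi\nabla_TV$ with the Sasakian value
of $\nabla\varphi$, computed by the chain rule in the chart at $\gamma(t)$. -/
theorem covDerivAlong_φ (S : ContactMetricStructure n N) (hS : S.IsSasakian)
    (hγ : ContMDiffAt 𝓘(ℝ, ℝ) (𝓡 (2 * n + 1)) ∞ γ t) (hV : DiffAlongAt γ V t) :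
    covDerivAlong S.g γ (fun s => S.φ (γ s) (V s)) t =
      S.g.inner (γ t) (velocity γ t) (V t) • S.ξ (γ t) - S.η (γ t) (V t) • velocity γ t
        + S.φ (γ t) (covDerivAlong S.g γ V t) := by
  obtain ⟨U, hUt, hpU, hloc⟩ := S.exists_localSasaki hS (γ t)
  have hc := hasDerivAt_extChartAt_comp hγ
  have hφ := LocalSasaki.hasFDerivAt_of_contDiffOn hloc.isOpen hpU hloc.smooth_φ
  have h2 := (hasDerivAt_endo_apply hφ hc hV.hasDerivAt).congr_of_eventuallyEq (S.coordAlong_φ hγ)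
  have h3 := hloc.covEndo_eq hpU (velocity γ t) (V t)
  rw [coordAlong_self] at h2
  rw [coordEndo_center] at h2 h3
  rw [metricInChart_center, coordField_center, coordForm_center] at h3
  rw [h3] at h2
  have key : ∀ (Γ φ : Model (2 * n + 1) →L[ℝ] Model (2 * n + 1)) (x v w : Model (2 * n + 1)),
      x - Γ (φ v) + φ (Γ v) + φ w + Γ (φ v) = x + φ (w + Γ v) := fun Γ φ x v w => by
    rw [map_add]; abel
  rw [covDerivAlong_eq, covDerivAlong_eq, h2.deriv]
  exact key (leviCivita (metricInChart S.g (γ t)) (extChartAt (𝓡 (2 * n + 1)) (γ t) (γ t))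
    (velocity γ t)) (S.φ (γ t)) _ (V t) _

omit [T2Space N] in
theorem inner_curvature_φ (S : ContactMetricStructure n N) {c : ℝ}
    (hS : S.HasConstantPhiSectionalCurvature c) (x : N) (u : TangentSpace (𝓡 (2 * n + 1)) x)
    (hu : S.g.inner x u u = 1) (hξ : S.g.inner x u (S.ξ x) = 0) :
    S.g.inner x (curvature S.g x u (S.φ x u) (S.φ x u)) u = c := by
  have h2 := hS x u hu hξ
  have h0 : S.η x u = 0 := ((S.almostContactMetric x).g_ξ_right u).symm.trans hξ
  have h3 : S.g.inner x (S.φ x u) (S.φ x u) = 1 := by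
    rw [S.g_φ, h0, hu]; norm_num
  have h4 : S.g.inner x u (S.φ x u) = 0 :=
    (S.g.symm x _ _).trans ((S.almostContactMetric x).g_φ_self u)
  rw [sectionalCurvature, hu, h3, h4] at h2
  simpa using h2

/-- The pointwise algebra applies at the centre of the chart at `x`, where coordinate expressions
coincide with the tensors themselves. -/
theorem curvature_φ (S : ContactMetricStructure n N) {c : ℝ} (hS : S.IsSasakianSpaceForm c)
    (x : N) (v : TangentSpace (𝓡 (2 * n + 1)) x) (hv : S.η x v = 0) :
    curvature S.g x v (S.φ x v) v = -((c * S.g.inner x v v) • S.φ x v) := by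
  obtain ⟨U, hUt, hpU, hloc⟩ := S.exists_localSasaki hS.1 x
  have hcurv := hloc.sasakiCurvature hpU
  rw [metricInChart_center, coordEndo_center, coordField_center, coordForm_center] at hcurv
  have h1 := hcurv.curv_eq_neg (c := c) (fun u hu hξ =>
    (congrArg (fun w => S.g.inner x w u) (curvature_eq S.g x u _ _)).symm.trans
      (S.inner_curvature_φ hS.2 x u hu hξ)) v hv
  exact (curvature_eq S.g x v _ v).trans h1

end ContactMetricStructure

/-! ### Frenet curves, tension and harmonicity -/

section Frenet

variable {d : ℕ} {N : Type*} [TopologicalSpace N] [ChartedSpace (Model d) N]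
  [IsManifold (𝓡 d) ∞ N] {g : Metric d N} {J : Set ℝ} {γ : ℝ → N} {r : ℕ}
  {E : ℕ → ∀ t, TangentSpace (𝓡 d) (γ t)} {κ : ℕ → ℝ → ℝ} {t : ℝ}

theorem IsFrenet.diffAlongAt (hF : IsFrenet g J γ r E κ) (hJ : IsOpen J) (ht : t ∈ J) {i : ℕ}
    (hi : i ∈ Set.Icc 1 r) : DiffAlongAt γ (E i) t :=
  diffAlongAt_of_contMDiffAt ((hF.smooth_frame i hi).contMDiffAt (hJ.mem_nhds ht))

theorem IsFrenet.eventually_velocity (hF : IsFrenet g J γ r E κ) (hJ : IsOpen J) (ht : t ∈ J) :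
    ∀ᶠ s in nhds t, E 1 s = velocity γ s :=
  Filter.eventually_of_mem (hJ.mem_nhds ht) hF.first

theorem IsFrenet.tension_eq (hF : IsFrenet g J γ r E κ) (hJ : IsOpen J) (ht : t ∈ J) :
    tension g γ t = if 1 < r then κ 1 t • E 2 t else 0 := by
  rw [tension, ← covDerivAlong_congr g (hF.eventually_velocity hJ ht),
    hF.frenet t ht 1 ⟨le_rfl, hF.one_le⟩]
  simp

/-- The left side does not involve the frame, so $\kappa_1$ can be compared between two Frenet
frames of the same curve. -/
theorem IsFrenet.inner_tension (hF : IsFrenet g J γ r E κ) (hJ : IsOpen J) (ht : t ∈ J)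
    (hr : 1 < r) : g.inner (γ t) (tension g γ t) (tension g γ t) = κ 1 t ^ 2 := by
  have h := hF.orthonormal t ht 2 ⟨one_le_two, hr⟩ 2 ⟨one_le_two, hr⟩
  rw [if_pos rfl] at h
  rw [hF.tension_eq hJ ht, if_pos hr, map_smul, map_smul, smul_apply, h]
  simp [sq]

theorem isBiharmonic_of_isHarmonic (hJ : IsOpen J) (h : IsHarmonic g J γ) :
    IsBiharmonic g J γ := by
  intro t ht
  have h1 : ∀ s ∈ J, covDerivAlong g γ (tension g γ) s = 0 := fun s hs => by
    rw [covDerivAlong_congr g (Filter.eventually_of_mem (hJ.mem_nhds hs) h), covDerivAlong_zero]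
  rw [bitension, covDerivAlong_congr g (Filter.eventually_of_mem (hJ.mem_nhds ht) h1),
    covDerivAlong_zero, h t ht, curvature_zero_middle, sub_zero]

theorem IsFrenet.isHarmonic (hF : IsFrenet g J γ 1 E κ) (hJ : IsOpen J) : IsHarmonic g J γ :=
  fun t ht => by rw [hF.tension_eq hJ ht]; simp

end Frenet

/-! ### Legendre curves with principal normal parallel to $\varphi T$ -/

namespace ContactMetricStructure

variable {n : ℕ} {N : Type*} [TopologicalSpace N] [ChartedSpace (Model (2 * n + 1)) N]
  [IsManifold (𝓡 (2 * n + 1)) ∞ N] {S : ContactMetricStructure n N} {J : Set ℝ} {γ : ℝ → N}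
  {r : ℕ} {E : ℕ → ∀ t, TangentSpace (𝓡 (2 * n + 1)) (γ t)} {κ : ℕ → ℝ → ℝ} {t : ℝ}

theorem inner_velocity (hF : IsFrenet S.g J γ r E κ) (ht : t ∈ J) :
    S.g.inner (γ t) (velocity γ t) (velocity γ t) = 1 := by
  have h := hF.orthonormal t ht 1 ⟨le_rfl, hF.one_le⟩ 1 ⟨le_rfl, hF.one_le⟩
  rwa [if_pos rfl, hF.first t ht] at h

theorem φ_φ_velocity (hL : S.IsLegendre J γ) (ht : t ∈ J) :
    S.φ (γ t) (S.φ (γ t) (velocity γ t)) = -velocity γ t := by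
  rw [S.φ_sq, hL t ht, zero_smul, add_zero]

theorem inner_φ_velocity (hF : IsFrenet S.g J γ r E κ) (hL : S.IsLegendre J γ) (ht : t ∈ J) :
    S.g.inner (γ t) (S.φ (γ t) (velocity γ t)) (S.φ (γ t) (velocity γ t)) = 1 := by
  rw [S.g_φ, inner_velocity hF ht, hL t ht]
  norm_num

/-- The factor is $g(E_2,\varphi E_1)$: continuous, of square 1 because $E_2$ and $\varphi T$ are
unit vectors, hence constant on an interval. -/
theorem exists_sign (hJ_interval : J.OrdConnected) (hγ : ContMDiffOn 𝓘(ℝ, ℝ) (𝓡 (2 * n + 1)) ∞ γ J)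
    (hL : S.IsLegendre J γ) (hF : IsFrenet S.g J γ r E κ) (hr : 2 ≤ r)
    (hpar : ∀ t ∈ J, ∃ a : ℝ, E 2 t = a • S.φ (γ t) (velocity γ t)) :
    ∃ ε : ℝ, (ε = 1 ∨ ε = -1) ∧ ∀ t ∈ J, E 2 t = ε • S.φ (γ t) (velocity γ t) := by
  set a : ℝ → ℝ := fun t => S.g.inner (γ t) (E 2 t) (S.φ (γ t) (E 1 t)) with ha
  have a_cont : ContinuousOn a J := by
    intro t ht
    have h1 : ContMDiffWithinAt 𝓘(ℝ, ℝ) ((𝓡 (2 * n + 1)).prod 𝓘(ℝ, ℝ)) ∞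
        (fun m ↦ Bundle.TotalSpace.mk' ℝ (E := Bundle.Trivial N ℝ) (γ m)
          (S.g.inner (γ m) (E 2 m) (S.φ (γ m) (E 1 m)))) J t := by
      apply ContMDiffWithinAt.clm_bundle_apply₂ (F₁ := Model (2 * n + 1))
        (F₂ := Model (2 * n + 1))
      · exact ContMDiffAt.comp_contMDiffWithinAt t S.g.contMDiff.contMDiffAt (hγ t ht)
      · exact hF.smooth_frame 2 ⟨one_le_two, hr⟩ t ht
      · apply ContMDiffWithinAt.clm_bundle_apply (F₁ := Model (2 * n + 1))
        · exact ContMDiffAt.comp_contMDiffWithinAt t S.smooth_φ.contMDiffAt (hγ t ht)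
        · exact hF.smooth_frame 1 ⟨le_rfl, hF.one_le⟩ t ht
    exact (Bundle.contMDiffWithinAt_totalSpace.1 h1).2.continuousWithinAt
  have a_spec : ∀ t ∈ J, E 2 t = a t • S.φ (γ t) (velocity γ t) ∧ a t * a t = 1 := fun t ht => by
    obtain ⟨b, hb⟩ := hpar t ht
    have h1 := inner_φ_velocity hF hL ht
    have hab : a t = b := by
      simp only [ha]
      rw [hF.first t ht, hb, map_smul, smul_apply, h1, smul_eq_mul, mul_one]
    have h2 := hF.orthonormal t ht 2 ⟨one_le_two, hr⟩ 2 ⟨one_le_two, hr⟩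
    rw [if_pos rfl, hb, map_smul, map_smul, smul_apply, h1, smul_eq_mul, smul_eq_mul,
      mul_one] at h2
    rw [hab]
    exact ⟨hb, h2⟩
  obtain ⟨ε, hε, hconst⟩ := hJ_interval.isPreconnected.eqOn_const_of_mapsTo
    (T := ({1, -1} : Set ℝ)) (Set.toFinite _).isDiscrete a_cont (fun t ht => mul_self_eq_one_iff.1 (a_spec t ht).2)
    ⟨1, Or.inl rfl⟩
  refine ⟨ε, hε, fun t ht => ?_⟩
  rw [(a_spec t ht).1, hconst ht]
  rfl

theorem φ_velocity_diffAlongAt (hJ : IsOpen J)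
    (hF : IsFrenet S.g J γ r E κ) (hr : 2 ≤ r) {ε : ℝ} (hε : ε = 1 ∨ ε = -1)
    (hE : ∀ t ∈ J, E 2 t = ε • S.φ (γ t) (velocity γ t)) (ht : t ∈ J) :
    DiffAlongAt γ (fun s => S.φ (γ s) (velocity γ s)) t := by
  refine ((hF.diffAlongAt hJ ht ⟨one_le_two, hr⟩).smul
    (differentiableAt_const (c := ε))).congr ?_
  filter_upwards [hJ.mem_nhds ht] with s hs
  rw [hE s hs, smul_smul]
  rcases hε with rfl | rfl <;> simp

variable [T2Space N]

theorem covDerivAlong_φ_velocity (hS : S.IsSasakian) (hJ : IsOpen J)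
    (hγ : ContMDiffOn 𝓘(ℝ, ℝ) (𝓡 (2 * n + 1)) ∞ γ J) (hL : S.IsLegendre J γ)
    (hF : IsFrenet S.g J γ r E κ) (ht : t ∈ J) :
    covDerivAlong S.g γ (fun s => S.φ (γ s) (velocity γ s)) t =
      S.ξ (γ t) + S.φ (γ t) (tension S.g γ t) := by
  have hV : DiffAlongAt γ (velocity γ) t :=
    (hF.diffAlongAt hJ ht ⟨le_rfl, hF.one_le⟩).congr (hF.eventually_velocity hJ ht)
  rw [S.covDerivAlong_φ hS (hγ.contMDiffAt (hJ.mem_nhds ht)) hV, inner_velocity hF ht, hL t ht,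
    one_smul, zero_smul, sub_zero]
  rfl

/-- The Frenet frame of a Legendre curve whose principal normal is parallel to `φ T`. -/
theorem frenet_frame (hS : S.IsSasakian) (hJ : IsOpen J) (hJ_nonempty : J.Nonempty)
    (hγ : ContMDiffOn 𝓘(ℝ, ℝ) (𝓡 (2 * n + 1)) ∞ γ J) (hL : S.IsLegendre J γ)
    (hF : IsFrenet S.g J γ r E κ) (hr : 2 ≤ r) {ε : ℝ} (hε : ε = 1 ∨ ε = -1)
    (hE : ∀ t ∈ J, E 2 t = ε • S.φ (γ t) (velocity γ t)) :
    r = 3 ∧ ∀ t ∈ J, κ 2 t = 1 ∧ E 3 t = ε • S.ξ (γ t) := by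
  have hεε : ε * ε = 1 := by rcases hε with rfl | rfl <;> norm_num
  -- Here $\nabla_T(\varepsilon\varphi
  -- T)=\varepsilon\xi+\kappa_1\varphi^2T=\varepsilon\xi-\kappa_1T$; the term $-\kappa_1T$ cancels
  -- against the Frenet equation. The conditional excludes $r=2$ below, as $\xi\ne0$.
  have step : ∀ t ∈ J, (if 2 < r then κ 2 t • E 3 t else 0) = ε • S.ξ (γ t) := fun t ht => by
    have h1 := hF.frenet t ht 2 ⟨one_le_two, hr⟩
    rw [covDerivAlong_congr S.g (W := fun s => ε • S.φ (γ s) (velocity γ s))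
        (Filter.eventually_of_mem (hJ.mem_nhds ht) hE),
      covDerivAlong_smul S.g (f := fun _ => ε) (differentiableAt_const ε)
        (φ_velocity_diffAlongAt hJ hF hr hε hE ht),
      covDerivAlong_φ_velocity hS hJ hγ hL hF ht, hF.tension_eq hJ ht, if_pos (show 1 < r from hr), hE t ht,
      map_smul, map_smul, φ_φ_velocity hL ht, if_pos one_lt_two, hF.first t ht] at h1
    simp only [deriv_const, zero_smul, zero_add, smul_add, smul_neg, smul_smul] at h1
    have h2 : ε * (κ 1 t * ε) = κ 1 t := by linear_combination κ 1 t * hεε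
    rw [h2, add_comm (ε • S.ξ (γ t))] at h1
    exact (add_left_cancel h1).symm
  have inner_ξ : ∀ t, S.g.inner (γ t) (S.ξ (γ t)) (S.ξ (γ t)) = 1 := fun t =>
    ((S.almostContactMetric (γ t)).g_ξ_right (S.ξ (γ t))).trans (S.η_ξ _)
  have hr3 : 2 < r := by
    obtain ⟨t, ht⟩ := hJ_nonempty
    by_contra hlt
    have h1 := step t ht
    rw [if_neg hlt] at h1
    have h2 := inner_ξ t
    have h3 : S.ξ (γ t) = 0 := by
      have := congrArg (fun v => ε • v) h1
      simpa [smul_smul, hεε] using this.symm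
    rw [h3] at h2
    simp at h2
  have third : ∀ t ∈ J, κ 2 t = 1 ∧ E 3 t = ε • S.ξ (γ t) := fun t ht => by
    have h1 := step t ht
    rw [if_pos hr3] at h1
    have h2 := hF.orthonormal t ht 3 ⟨by norm_num, hr3⟩ 3 ⟨by norm_num, hr3⟩
    have h3 := congrArg (fun v => S.g.inner (γ t) v v) h1
    simp only [map_smul, smul_apply, h2, inner_ξ, smul_eq_mul, if_true, mul_one, hεε] at h3
    have h4 := hF.curvature_pos t ht 2 ⟨one_le_two, hr3⟩
    have h5 : κ 2 t = 1 := by nlinarith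
    rw [h5, one_smul] at h1
    exact ⟨h5, h1⟩
  refine ⟨le_antisymm ?_ hr3, third⟩
  by_contra hlt
  rw [not_le] at hlt
  obtain ⟨t, ht⟩ := hJ_nonempty
  have hξd : DiffAlongAt γ (fun s => S.ξ (γ s)) t := by
    refine ((hF.diffAlongAt hJ ht (i := 3) ⟨by norm_num, hr3⟩).smul
      (differentiableAt_const (c := ε))).congr ?_
    filter_upwards [hJ.mem_nhds ht] with s hs
    rw [(third s hs).2, smul_smul, hεε, one_smul]
  -- If $r\ge4$, then $\nabla_TE_3=-\varepsilon\varphi T=-\kappa_2E_2$ leaves $\kappa_3E_4=0$,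
  -- contradicting $\kappa_3>0$ and $|E_4|=1$.
  have h1 := hF.frenet t ht 3 ⟨by norm_num, hr3⟩
  rw [covDerivAlong_congr S.g (W := fun s => ε • S.ξ (γ s))
      (Filter.eventually_of_mem (hJ.mem_nhds ht) fun s hs => (third s hs).2),
    covDerivAlong_smul S.g (f := fun _ => ε) (differentiableAt_const ε) hξd,
    S.covDerivAlong_ξ hS (hγ.contMDiffAt (hJ.mem_nhds ht)), if_pos (by norm_num), if_pos hlt,
    show 3 - 1 = 2 from rfl, show 3 + 1 = 4 from rfl, (third t ht).1, hE t ht] at h1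
  simp only [deriv_const, zero_smul, zero_add, smul_neg, one_smul] at h1
  have h2 : κ 3 t • E 4 t = 0 := by
    have := (add_eq_left (a := -(ε • S.φ (γ t) (velocity γ t)))).1 h1.symm
    exact this
  have h3 := hF.orthonormal t ht 4 ⟨by norm_num, hlt⟩ 4 ⟨by norm_num, hlt⟩
  have h4 := hF.curvature_pos t ht 3 ⟨by norm_num, hlt⟩
  have h5 : E 4 t = 0 := (smul_eq_zero.1 h2).resolve_left h4.ne'
  rw [h5] at h3
  simp at h3

theorem bitension_eq {c : ℝ} (hS : S.IsSasakianSpaceForm c) (hJ : IsOpen J)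
    (hL : S.IsLegendre J γ) (hF : IsFrenet S.g J γ 3 E κ) {ε : ℝ}
    (hE : ∀ t ∈ J, E 2 t = ε • S.φ (γ t) (velocity γ t)) (hκ : ∀ t ∈ J, κ 2 t = 1) (ht : t ∈ J) :
    bitension S.g γ t = (-3 * κ 1 t * deriv (κ 1) t) • E 1 t
      + (deriv (deriv (κ 1)) t - κ 1 t ^ 3 - κ 1 t + c * κ 1 t) • E 2 t
      + (2 * deriv (κ 1) t) • E 3 t := by
  have hk := hF.smooth_curvature 1 ⟨le_rfl, by norm_num⟩
  have k_diff : ∀ s ∈ J, DifferentiableAt ℝ (κ 1) s := fun s hs =>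
    (hk.contDiffAt (hJ.mem_nhds hs)).differentiableAt (by simp)
  have k_diff' : ∀ s ∈ J, DifferentiableAt ℝ (deriv (κ 1)) s := fun s hs =>
    ((hk.deriv_of_isOpen hJ (m := ∞) (by simp)).contDiffAt (hJ.mem_nhds hs)).differentiableAt
      (by simp)
  have dE : ∀ s ∈ J, ∀ i ∈ Set.Icc 1 3, DiffAlongAt γ (E i) s := fun s hs i hi =>
    hF.diffAlongAt hJ hs hi
  have D1 : ∀ s ∈ J, covDerivAlong S.g γ (E 1) s = κ 1 s • E 2 s := fun s hs => by
    rw [hF.frenet s hs 1 ⟨le_rfl, by norm_num⟩]; simp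
  have D2 : ∀ s ∈ J, covDerivAlong S.g γ (E 2) s = -(κ 1 s • E 1 s) + E 3 s := fun s hs => by
    rw [hF.frenet s hs 2 ⟨by norm_num, by norm_num⟩]; simp [hκ s hs]
  have D3 : ∀ s ∈ J, covDerivAlong S.g γ (E 3) s = -E 2 s := fun s hs => by
    rw [hF.frenet s hs 3 ⟨by norm_num, by norm_num⟩]; simp [hκ s hs]
  have T1 : ∀ s ∈ J, tension S.g γ s = κ 1 s • E 2 s := fun s hs => by
    rw [hF.tension_eq hJ hs, if_pos (by norm_num)]
  have T2 : ∀ s ∈ J, covDerivAlong S.g γ (tension S.g γ) s =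
      (-(κ 1 s * κ 1 s)) • E 1 s + deriv (κ 1) s • E 2 s + κ 1 s • E 3 s := fun s hs => by
    rw [covDerivAlong_congr S.g (Filter.eventually_of_mem (hJ.mem_nhds hs) T1),
      covDerivAlong_smul S.g (k_diff s hs) (dE s hs 2 ⟨by norm_num, by norm_num⟩), D2 s hs]
    module
  have e1 := dE t ht 1 ⟨by norm_num, by norm_num⟩
  have e2 := dE t ht 2 ⟨by norm_num, by norm_num⟩
  have e3 := dE t ht 3 ⟨by norm_num, by norm_num⟩
  have f1 : DifferentiableAt ℝ (fun s => -(κ 1 s * κ 1 s)) t :=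
    ((k_diff t ht).mul (k_diff t ht)).neg
  have f1' : deriv (fun s => -(κ 1 s * κ 1 s)) t = -(2 * κ 1 t * deriv (κ 1) t) := by
    rw [deriv.fun_neg, deriv_fun_mul (k_diff t ht) (k_diff t ht)]
    ring
  have hcurv : curvature S.g (γ t) (velocity γ t) (κ 1 t • E 2 t) (velocity γ t) =
      -((c * κ 1 t) • E 2 t) := by
    have h1 := S.curvature_φ hS (γ t) (velocity γ t) (hL t ht)
    rw [inner_velocity hF ht, mul_one] at h1
    rw [hE t ht, curvature_smul_middle, curvature_smul_middle, h1]
    module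
  rw [bitension, covDerivAlong_congr S.g (Filter.eventually_of_mem (hJ.mem_nhds ht) T2),
    covDerivAlong_add S.g ((e1.smul f1).add (e2.smul (k_diff' t ht))) (e3.smul (k_diff t ht)),
    covDerivAlong_add S.g (e1.smul f1) (e2.smul (k_diff' t ht)), covDerivAlong_smul S.g f1 e1,
    covDerivAlong_smul S.g (k_diff' t ht) e2, covDerivAlong_smul S.g (k_diff t ht) e3, D1 t ht,
    D2 t ht, D3 t ht, f1', T1 t ht, hcurv]
  module

/-- The $E_3$-coefficient of the bitension gives $\kappa_1'=0$, and then the $E_2$-coefficient is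
$\kappa_1(c-1-\kappa_1^2)$ with $\kappa_1>0$. Conversely, constancy of $\kappa_1^2$ and positivity
give $\kappa_1'=0$. -/
theorem isBiharmonic_iff {c : ℝ} (hS : S.IsSasakianSpaceForm c) (hJ : IsOpen J)
    (hL : S.IsLegendre J γ) (hF : IsFrenet S.g J γ 3 E κ) {ε : ℝ}
    (hE : ∀ t ∈ J, E 2 t = ε • S.φ (γ t) (velocity γ t)) (hκ : ∀ t ∈ J, κ 2 t = 1) :
    IsBiharmonic S.g J γ ↔ ∀ t ∈ J, κ 1 t ^ 2 = c - 1 := by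
  have hk := hF.smooth_curvature 1 ⟨le_rfl, by norm_num⟩
  have hpos : ∀ t ∈ J, 0 < κ 1 t := fun t ht => hF.curvature_pos t ht 1 ⟨le_rfl, by norm_num⟩
  have k_diff : ∀ s ∈ J, DifferentiableAt ℝ (κ 1) s := fun s hs =>
    (hk.contDiffAt (hJ.mem_nhds hs)).differentiableAt (by simp)
  have second : ∀ t ∈ J, (∀ s ∈ J, deriv (κ 1) s = 0) → deriv (deriv (κ 1)) t = 0 :=
    fun t ht h => by
      have : deriv (κ 1) =ᶠ[nhds t] fun _ => 0 := Filter.eventually_of_mem (hJ.mem_nhds ht) h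
      rw [this.deriv_eq, deriv_const]
  constructor
  · intro h
    have coeff : ∀ t ∈ J, ∀ j ∈ Set.Icc 1 3, S.g.inner (γ t) (bitension S.g γ t) (E j t) = 0 :=
      fun t ht j _ => by rw [h t ht]; simp
    have k' : ∀ t ∈ J, deriv (κ 1) t = 0 := fun t ht => by
      have h1 := coeff t ht 3 ⟨by norm_num, by norm_num⟩
      have o1 := hF.orthonormal t ht 1 ⟨by norm_num, by norm_num⟩ 3 ⟨by norm_num, by norm_num⟩
      have o2 := hF.orthonormal t ht 2 ⟨by norm_num, by norm_num⟩ 3 ⟨by norm_num, by norm_num⟩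
      have o3 := hF.orthonormal t ht 3 ⟨by norm_num, by norm_num⟩ 3 ⟨by norm_num, by norm_num⟩
      rw [bitension_eq hS hJ hL hF hE hκ ht] at h1
      simp only [map_add, map_smul, add_apply, smul_apply, o1, o2, o3] at h1
      simpa using h1
    intro t ht
    have h1 := coeff t ht 2 ⟨by norm_num, by norm_num⟩
    have o1 := hF.orthonormal t ht 1 ⟨by norm_num, by norm_num⟩ 2 ⟨by norm_num, by norm_num⟩
    have o2 := hF.orthonormal t ht 2 ⟨by norm_num, by norm_num⟩ 2 ⟨by norm_num, by norm_num⟩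
    have o3 := hF.orthonormal t ht 3 ⟨by norm_num, by norm_num⟩ 2 ⟨by norm_num, by norm_num⟩
    rw [bitension_eq hS hJ hL hF hE hκ ht] at h1
    simp only [map_add, map_smul, add_apply, smul_apply, o1, o2, o3, k' t ht, second t ht k'] at h1
    simp at h1
    have h2 : κ 1 t * (c - 1 - κ 1 t ^ 2) = 0 := by linear_combination h1
    have h3 := (mul_eq_zero.1 h2).resolve_left (hpos t ht).ne'
    linarith
  · intro h t ht
    have k' : ∀ t ∈ J, deriv (κ 1) t = 0 := fun t ht => by
      have h1 : (fun s => κ 1 s ^ 2) =ᶠ[nhds t] fun _ => c - 1 :=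
        Filter.eventually_of_mem (hJ.mem_nhds ht) h
      have h2 := h1.deriv_eq
      rw [deriv_const, deriv_fun_pow (k_diff t ht)] at h2
      have := (hpos t ht).ne'
      simpa [this] using h2
    rw [bitension_eq hS hJ hL hF hE hκ ht, k' t ht, second t ht k']
    have h1 : 0 - κ 1 t ^ 3 - κ 1 t + c * κ 1 t = 0 := by linear_combination (-κ 1 t) * h t ht
    rw [h1]
    simp

end ContactMetricStructure
end Sasaki

end
-- The classification
theorem mainTheorem3 {n : ℕ} {N : Type*} [TopologicalSpace N] [T2Space N]
    [ChartedSpace (Sasaki.Model (2 * n + 1)) N] [IsManifold (𝓡 (2 * n + 1)) ∞ N]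
    (S : Sasaki.ContactMetricStructure n N) (c : ℝ) (hS : S.IsSasakianSpaceForm c) (hc : c ≠ 1)
    (J : Set ℝ) (hJ_open : IsOpen J) (hJ_interval : J.OrdConnected) (hJ_nonempty : J.Nonempty)
    (γ : ℝ → N) (hγ : ContMDiffOn 𝓘(ℝ, ℝ) (𝓡 (2 * n + 1)) ∞ γ J) (hL : S.IsLegendre J γ)
    (r : ℕ) (E : ℕ → ∀ t, TangentSpace (𝓡 (2 * n + 1)) (γ t)) (κ : ℕ → ℝ → ℝ)
    (hF : Sasaki.IsFrenet S.g J γ r E κ)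
    (hpar : 2 ≤ r → ∀ t ∈ J, ∃ a : ℝ, E 2 t = a • S.φ (γ t) (Sasaki.velocity γ t)) :
    (2 ≤ r → r = 3 ∧ ∃ ε : ℝ, (ε = 1 ∨ ε = -1) ∧ ∀ t ∈ J,
      E 1 t = Sasaki.velocity γ t ∧
      E 2 t = ε • S.φ (γ t) (Sasaki.velocity γ t) ∧
      E 3 t = ε • S.ξ (γ t)) ∧
    (c < 1 → (Sasaki.IsBiharmonic S.g J γ ↔ Sasaki.IsGeodesic S.g J γ)) ∧
    (1 < c → (Sasaki.IsProperBiharmonic S.g J γ ↔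
      ∃ k₁ k₂ : ℝ, Sasaki.IsHelix S.g J γ k₁ k₂ ∧ k₁ ^ 2 = c - 1 ∧ k₂ = 1)) := by
  have frame : 2 ≤ r → r = 3 ∧ ∃ ε : ℝ, (ε = 1 ∨ ε = -1) ∧ ∀ t ∈ J,
      E 2 t = ε • S.φ (γ t) (Sasaki.velocity γ t) ∧ κ 2 t = 1 ∧ E 3 t = ε • S.ξ (γ t) := fun hr => by
    obtain ⟨ε, hε, hE⟩ := Sasaki.ContactMetricStructure.exists_sign hJ_interval hγ hL hF hr (hpar hr)
    obtain ⟨h3, h⟩ := Sasaki.ContactMetricStructure.frenet_frame hS.1 hJ_open hJ_nonempty hγ hL hF hr hε hE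
    exact ⟨h3, ε, hε, fun t ht => ⟨hE t ht, h t ht⟩⟩
  have one_or : r = 1 ∨ 2 ≤ r := by have := hF.one_le; omega
  refine ⟨fun hr => ?_, fun hc1 => ⟨fun hb => ?_, ?_⟩, fun hc1 => ⟨fun hb => ?_, ?_⟩⟩
  · obtain ⟨h3, ε, hε, h⟩ := frame hr
    exact ⟨h3, ε, hε, fun t ht => ⟨hF.first t ht, (h t ht).1, (h t ht).2.2⟩⟩
  · rcases one_or with rfl | hr
    · exact ⟨E, κ, hF⟩
    · obtain ⟨rfl, ε, hε, h⟩ := frame hr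
      obtain ⟨t, ht⟩ := hJ_nonempty
      have h1 := (Sasaki.ContactMetricStructure.isBiharmonic_iff hS hJ_open hL hF (fun t ht => (h t ht).1)
        (fun t ht => (h t ht).2.1)).1 hb t ht
      -- For $c<1$ the equation $\kappa_1^2=c-1$ has no real solution, so only $r=1$ remains.
      nlinarith [sq_nonneg (κ 1 t)]
  · rintro ⟨E', κ', hF'⟩
    exact Sasaki.isBiharmonic_of_isHarmonic hJ_open (hF'.isHarmonic hJ_open)
  · rcases one_or with rfl | hr
    · exact absurd (hF.isHarmonic hJ_open) hb.2
    · obtain ⟨rfl, ε, hε, h⟩ := frame hr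
      have h1 := (Sasaki.ContactMetricStructure.isBiharmonic_iff hS hJ_open hL hF (fun t ht => (h t ht).1)
        (fun t ht => (h t ht).2.1)).1 hb.1
      refine ⟨Real.sqrt (c - 1), 1, ⟨E, κ, hF, fun t ht => ⟨?_, (h t ht).2.1⟩⟩,
        Real.sq_sqrt (by linarith), rfl⟩
      rw [← h1 t ht, Real.sqrt_sq (hF.curvature_pos t ht 1 ⟨le_rfl, by norm_num⟩).le]
  · rintro ⟨k₁, k₂, ⟨E', κ', hF', hκ'⟩, hk₁, -⟩
    -- The helix comes with its own frame, a priori different from `E`; the two are compared only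
    -- through $|\tau(\gamma)|^2=\kappa_1^2$.
    have norm_eq : ∀ t ∈ J, S.g.inner (γ t) (Sasaki.tension S.g γ t) (Sasaki.tension S.g γ t) = c - 1 :=
      fun t ht => by
        rw [hF'.inner_tension hJ_open ht (by norm_num), (hκ' t ht).1, hk₁]
    have not_harm : ¬ Sasaki.IsHarmonic S.g J γ := fun hh => by
      obtain ⟨t, ht⟩ := hJ_nonempty
      have h1 := norm_eq t ht
      rw [hh t ht] at h1
      simp at h1
      linarith
    refine ⟨?_, not_harm⟩
    rcases one_or with rfl | hr
    · exact absurd (hF.isHarmonic hJ_open) not_harm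
    · obtain ⟨rfl, ε, hε, h⟩ := frame hr
      refine (Sasaki.ContactMetricStructure.isBiharmonic_iff hS hJ_open hL hF (fun t ht => (h t ht).1)
        (fun t ht => (h t ht).2.1)).2 fun t ht => ?_
      rw [← norm_eq t ht, hF.inner_tension hJ_open ht (by norm_num)]
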